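/- **Programs.** Let $\mathbb N^+=\{1,2,\dots\}$ be the set of thread identifiers, and let $L$, $\mathcal M$, $\mathcal L$, $\mathcal C$ be the sets of program locations, memory states, mutexes and condition variables. A *program* $P$ consists of a set $T$ of statements $\langle i,n,n',q,r\rangle$ ($i\in\mathbb N^+$, $n,n'\in L$, $r\subseteq \mathcal M\times\mathcal M$, and $q$ an operation: $\mathsf{local}$, $\langle\mathsf{lock},l\rangle$, $\langle\mathsf{unlock},l\rangle$, $\langle\mathsf{wait},c,l\rangle$, $\langle\mathsf{signal},c\rangle$ or $\langle\mathsf{bcast},c\rangle$ with $l\in\mathcal L$, $c\in\mathcal C$), an initial memory $m_0$ and initial locations $p_0:\mathbb N^+\to L$. An *action* is a pair $\langle i,b\rangle$ of a thread and an effect; the effects are $\langle\mathsf{loc},t\rangle$ ($t$ a statement), $\langle\mathsf{acq},l\rangle$, $\langle\mathsf{rel},l\rangle$, $\langle\mathsf{w1},c,l\rangle$, $\langle\mathsf{w2},c,l\rangle$, $\langle\mathsf{sig},c,k\rangle$ ($k\in\mathbb N$), $\langle\mathsf{bro},c,W\rangle$ ($W\subseteq\mathbb N^+$). A *state* is a tuple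 $\langle p,m,u,v\rangle$ with $p:\mathbb N^+\to L$, $m\in\mathcal M$, $u:\mathcal L\to\mathbb N$ and $v(c)\subseteq\mathbb Z$ for $c\in\mathcal C$; the initial state is $\langle p_0,m_0,0,\emptyset\rangle$. If $t=\langle i,n,n',q,r\rangle\in T$ and $p(i)=n$, there are the following transitions from $\langle p,m,u,v\rangle$; all of them except $\mathsf{w1}$ set $p(i):=n'$, and what is not mentioned is unchanged. - $q=\mathsf{local}$: action $\langle i,\langle\mathsf{loc},t\rangle\rangle$, to any memory $m'$ with $(m,m')\in r$. - $q=\langle\mathsf{lock},l\rangle$, $u(l)=0$: $\langle i,\langle\mathsf{acq},l\rangle\rangle$, $u(l):=i$. - $q=\langle\mathsf{unlock},l\rangle$, $u(l)=i$: $\langle i,\langle\mathsf{rel},l\rangle\rangle$, $u(l):=0$. - $q=\langle\mathsf{wait},c,l\rangle$, $u(l)=i$: $\langle i,\langle\mathsf{w1},c,l\rangle\rangle$, $u(l):=0$, $v(c):=v(c)\cup\{i\}$. - $q=\langle\mathsf{wait},c,l\rangle$, $u(l)=0$, $-i\in v(c)$: $\langle i,\langle\mathsf{w2},c,l\rangle\rangle$,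 $u(l):=i$, $v(c):=v(c)\setminus\{-i\}$. - $q=\langle\mathsf{signal},c\rangle$, $j\in v(c)$, $j>0$: $\langle i,\langle\mathsf{sig},c,j\rangle\rangle$, $v(c):=(v(c)\setminus\{j\})\cup\{-j\}$. - $q=\langle\mathsf{signal},c\rangle$, no positive element in $v(c)$: $\langle i,\langle\mathsf{sig},c,0\rangle\rangle$. - $q=\langle\mathsf{bcast},c\rangle$, $W=\{j\in v(c):j>0\}$: $\langle i,\langle\mathsf{bro},c,W\rangle\rangle$, $v(c):=(v(c)\setminus W)\cup(-W)$. For a finite sequence $\sigma$ of actions, $\mathrm{state}(\sigma)$ is the set of states that $\sigma$ can reach from the initial state; a state is *reachable* if it lies in some $\mathrm{state}(\sigma)$. An action is enabled at a state if it labels a transition from it, and at a set of states if it is enabled at one of them. Actions $a$ and $a'$ *commute* at a state $s$ if (i) for each transition $s\xrightarrow{a}s'$, $a'$ is enabled at $s$ iff it is enabled at $s'$, and (ii) if both are enabled at $s$, then $aa'$ and $a'a$ can reach the same states from $s$. **Assumptions on $P$.** - *Data-race-free*: any two local actions $\langle i,\langle\mathsf{loc},t\rangle\rangle$, $\langle i',\langle\mathsf{loc},t'\rangle\rangle$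 with $i\neq i'$ commute at every reachable state. - *Well-formed*: for every $\sigma$, if two distinct actions of the same thread are enabled at $\mathrm{state}(\sigma)$, then both have $\mathsf{loc}$ effect or both have $\mathsf{sig}$ effect on the same condition variable. - *Waiting threads are suspended*: if $i\in v(c)$ or $-i\in v(c)$ at a reachable state, then every action of thread $i$ enabled there has $\mathsf{w2}$ effect. **Dependence.** Two actions are dependent if they belong to the same thread, or if, up to exchanging them, they are $\langle i,b\rangle$ and $\langle j,b'\rangle$ with: - $b,b'$ both among $\langle\mathsf{acq},l\rangle,\langle\mathsf{rel},l\rangle,\langle\mathsf{w1},\cdot,l\rangle,\langle\mathsf{w2},\cdot,l\rangle$, for the same $l$; - $b=\langle\mathsf{w1},c,\cdot\rangle$ and $b'$ one of $\langle\mathsf{sig},c,0\rangle$, $\langle\mathsf{sig},c,i\rangle$, $\langle\mathsf{bro},c,W\rangle$ ($W$ arbitrary); - $b=\langle\mathsf{w2},c,\cdot\rangle$ and $b'=\langle\mathsf{sig},c,i\rangle$, or $b'=\langle\mathsf{bro},c,W\rangle$ with $i\in W$; - $b=\langle\mathsf{sig},c,k\rangle$ with $k\ne0$ and $b'$ one of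 $\langle\mathsf{sig},c,0\rangle$, $\langle\mathsf{sig},c,k\rangle$, $\langle\mathsf{bro},c,W\rangle$; - $b=\langle\mathsf{bro},c,W\rangle$ with $W\neq\emptyset$ and $b'$ one of $\langle\mathsf{sig},c,k'\rangle$ ($k'\ge0$), $\langle\mathsf{bro},c,W'\rangle$. **Unfolding.** Events are pairs $e=\langle a,H\rangle$ of an action $h(e)=a$ and a finite set $\lceil e\rceil=H$ of events, generated inductively; $e'<e$ means $e'\in\lceil e\rceil$, and $e\mathrel{\#}e'$ (conflict) means that $e\ne e'$, $e\not<e'$, $e'\not<e$, and $h(e)$, $h(e')$ are dependent. A *configuration* is a finite set of events that contains the causes of its elements and no two elements in conflict. For a configuration $C$, $\mathrm{state}(C)$ is the set of states reached by an interleaving of $C$ (a sequence of the labels of the elements of $C$ in an order that extends $<$); all interleavings reach the same set. $\langle a,C\rangle$ is an event iff $C$ is a configuration, $a$ is enabled at $\mathrm{state}(C)$, and $a$ depends on $h(e')$ for every $<$-maximal $e'\in C$. Write $[e]=\lceil e\rceil\cup\{e\}$ and $[M]=\bigcup_{e\in M}[e]$. Put $\mathrm{ex}(C)=\{e \text{ event}: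 e\notin C,\ \lceil e\rceil\subseteq C\}$, $\mathrm{en}(C)=\{e\in\mathrm{ex}(C):C\cup\{e\}\text{ is a configuration}\}$, and let $\mathrm{cex}(C)=\mathrm{ex}(C)\setminus\mathrm{en}(C)$ be the set of *conflicting extensions* of $C$. **Procedure.** For an event $e=\langle\langle i,\langle\mathsf{w1},c,l\rangle\rangle,K\rangle$ let $e_t$ be the $<$-maximal event of thread $i$ in $K$ (read $[e_t]=\emptyset$ if there is none), and let $X'$ be the set of those events in $K\setminus[e_t]$ whose effect is $\langle\mathsf{sig},c,0\rangle$, $\langle\mathsf{bro},c,\emptyset\rangle$, or $\langle\mathsf{bro},c,S\rangle$ with $i\notin S$. Then $$\mathrm{cexwait}(e)=\bigl\{\langle h(e),[M]\cup[e_t]\rangle : M\subseteq X',\ \text{no two elements of } M \text{ are } <\text{-related},\ [M]\cup[e_t]\ne K\bigr\}.$$ **Lemma.** Let $P$ satisfy the three assumptions above, and let $C$ be $\subseteq$-maximal among the configurations $D$ of the unfolding of $P$ with $\mathrm{state}(D)\neq\emptyset$ (in particular, $C$ may be any maximal configuration with $\mathrm{state}(C)\ne\emptyset$). Then $$\bigcup_{e\in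 C,\ e\text{ has }\mathsf{w1}\text{ effect}}\mathrm{cexwait}(e)=\{e'\in\mathrm{cex}(C): e'\text{ has }\mathsf{w1}\text{ effect}\}.$$ -/

import Mathlib

/-!
Concurrent programs with POSIX mutexes and condition variables, their transition system,
their dependence relation, their unfolding, and the procedure that computes the conflicting
extensions of `w1` effect.
-/

noncomputable section

universe u

open scoped Classical

namespace Unf

/-! ### Programs -/

/-- Thread identifiers: the positive integers. -/
abbrev Thread := ℕ+

/-- Operations of statements, over mutexes `Lk` and condition variables `Cv`. -/
inductive Op (Lk Cv : Type*) where
  | loc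
  | lock (l : Lk)
  | unlock (l : Lk)
  | wait (c : Cv) (l : Lk)
  | signal (c : Cv)
  | bcast (c : Cv)

/-- A thread statement: `thread` can execute `op`, moving from location `src` to `tgt` and
updating the memory according to the relation `rel`. -/
structure Stmt (L Mem Lk Cv : Type*) where
  thread : Thread
  src : L
  tgt : L
  op : Op Lk Cv
  rel : Set (Mem × Mem)

/-- A concurrent program: its statements, initial memory and initial locations. -/
structure Program (L Mem Lk Cv : Type*) where
  stmts : Set (Stmt L Mem Lk Cv)
  m₀ : Mem
  p₀ : Thread → L

/-- Effects. In `sig c k`, `k` is the identifier of the thread that is woken up, and `k = 0`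
means that the signal is lost. In `bro c W`, `W` is the set of threads that are woken up. -/
inductive Effect (L Mem Lk Cv : Type*) where
  | loc (t : Stmt L Mem Lk Cv)
  | acq (l : Lk)
  | rel (l : Lk)
  | w1 (c : Cv) (l : Lk)
  | w2 (c : Cv) (l : Lk)
  | sig (c : Cv) (k : ℕ)
  | bro (c : Cv) (W : Set Thread)

/-- Actions: a thread together with an effect. -/
structure Action (L Mem Lk Cv : Type*) where
  thread : Thread
  effect : Effect L Mem Lk Cv

/-- States `⟨p, m, u, v⟩`: `u l` is `0` if the mutex `l` is free and otherwise the thread that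
holds it; `v c` holds the identifiers of the threads that wait on `c`, and the negated
identifiers of those that have been woken up but have not resumed yet. -/
structure State (L Mem Lk Cv : Type*) where
  p : Thread → L
  m : Mem
  u : Lk → ℕ
  v : Cv → Set ℤ

section Semantics

variable {L Mem Lk Cv : Type*}

/-- The labelled transition relation of a program. -/
inductive Step (P : Program L Mem Lk Cv) :
    State L Mem Lk Cv → Action L Mem Lk Cv → State L Mem Lk Cv → Prop
  | loc (p : Thread → L) (m m' : Mem) (u : Lk → ℕ) (v : Cv → Set ℤ)
      (i : Thread) (n n' : L) (r : Set (Mem × Mem))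
      (ht : ⟨i, n, n', .loc, r⟩ ∈ P.stmts) (hp : p i = n) (hr : (m, m') ∈ r) :
      Step P ⟨p, m, u, v⟩ ⟨i, .loc ⟨i, n, n', .loc, r⟩⟩ ⟨Function.update p i n', m', u, v⟩
  | acq (p : Thread → L) (m : Mem) (u : Lk → ℕ) (v : Cv → Set ℤ)
      (i : Thread) (n n' : L) (l : Lk) (r : Set (Mem × Mem))
      (ht : ⟨i, n, n', .lock l, r⟩ ∈ P.stmts) (hp : p i = n) (hu : u l = 0) :
      Step P ⟨p, m, u, v⟩ ⟨i, .acq l⟩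
        ⟨Function.update p i n', m, Function.update u l (i : ℕ), v⟩
  | rel (p : Thread → L) (m : Mem) (u : Lk → ℕ) (v : Cv → Set ℤ)
      (i : Thread) (n n' : L) (l : Lk) (r : Set (Mem × Mem))
      (ht : ⟨i, n, n', .unlock l, r⟩ ∈ P.stmts) (hp : p i = n) (hu : u l = (i : ℕ)) :
      Step P ⟨p, m, u, v⟩ ⟨i, .rel l⟩
        ⟨Function.update p i n', m, Function.update u l 0, v⟩
  | w1 (p : Thread → L) (m : Mem) (u : Lk → ℕ) (v : Cv → Set ℤ)
      (i : Thread) (n n' : L) (c : Cv) (l : Lk) (r : Set (Mem × Mem))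
      (ht : ⟨i, n, n', .wait c l, r⟩ ∈ P.stmts) (hp : p i = n) (hu : u l = (i : ℕ)) :
      Step P ⟨p, m, u, v⟩ ⟨i, .w1 c l⟩
        ⟨p, m, Function.update u l 0, Function.update v c (v c ∪ {((i : ℕ) : ℤ)})⟩
  | w2 (p : Thread → L) (m : Mem) (u : Lk → ℕ) (v : Cv → Set ℤ)
      (i : Thread) (n n' : L) (c : Cv) (l : Lk) (r : Set (Mem × Mem))
      (ht : ⟨i, n, n', .wait c l, r⟩ ∈ P.stmts) (hp : p i = n) (hu : u l = 0)
      (hv : -((i : ℕ) : ℤ) ∈ v c) :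
      Step P ⟨p, m, u, v⟩ ⟨i, .w2 c l⟩
        ⟨Function.update p i n', m, Function.update u l (i : ℕ),
          Function.update v c (v c \ {-((i : ℕ) : ℤ)})⟩
  | sig (p : Thread → L) (m : Mem) (u : Lk → ℕ) (v : Cv → Set ℤ)
      (i : Thread) (n n' : L) (c : Cv) (r : Set (Mem × Mem)) (j : Thread)
      (ht : ⟨i, n, n', .signal c, r⟩ ∈ P.stmts) (hp : p i = n) (hv : ((j : ℕ) : ℤ) ∈ v c) :
      Step P ⟨p, m, u, v⟩ ⟨i, .sig c (j : ℕ)⟩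
        ⟨Function.update p i n', m, u,
          Function.update v c ((v c \ {((j : ℕ) : ℤ)}) ∪ {-((j : ℕ) : ℤ)})⟩
  | sigLost (p : Thread → L) (m : Mem) (u : Lk → ℕ) (v : Cv → Set ℤ)
      (i : Thread) (n n' : L) (c : Cv) (r : Set (Mem × Mem))
      (ht : ⟨i, n, n', .signal c, r⟩ ∈ P.stmts) (hp : p i = n) (hv : ∀ j ∈ v c, ¬ 0 < j) :
      Step P ⟨p, m, u, v⟩ ⟨i, .sig c 0⟩ ⟨Function.update p i n', m, u, v⟩
  | bro (p : Thread → L) (m : Mem) (u : Lk → ℕ) (v : Cv → Set ℤ)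
      (i : Thread) (n n' : L) (c : Cv) (r : Set (Mem × Mem)) (W : Set Thread)
      (ht : ⟨i, n, n', .bcast c, r⟩ ∈ P.stmts) (hp : p i = n)
      (hW : W = {j : Thread | ((j : ℕ) : ℤ) ∈ v c}) :
      Step P ⟨p, m, u, v⟩ ⟨i, .bro c W⟩
        ⟨Function.update p i n', m, u,
          Function.update v c ((v c \ {z | ∃ j ∈ W, z = ((j : ℕ) : ℤ)}) ∪
            {z | ∃ j ∈ W, z = -((j : ℕ) : ℤ)})⟩

/-- The initial state. -/
def Program.init (P : Program L Mem Lk Cv) : State L Mem Lk Cv :=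
  ⟨P.p₀, P.m₀, fun _ => 0, fun _ => ∅⟩

/-- The action `a` is enabled at the state `s`. -/
def Enabled (P : Program L Mem Lk Cv) (s : State L Mem Lk Cv) (a : Action L Mem Lk Cv) : Prop :=
  ∃ s', Step P s a s'

/-- The action `a` is enabled at some state of the set `X`. -/
def EnabledAt (P : Program L Mem Lk Cv) (X : Set (State L Mem Lk Cv))
    (a : Action L Mem Lk Cv) : Prop :=
  ∃ s ∈ X, Enabled P s a

/-- The set of states that the sequence `σ` of actions can reach from `s`. -/
def statesFrom (P : Program L Mem Lk Cv) (s : State L Mem Lk Cv)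
    (σ : List (Action L Mem Lk Cv)) : Set (State L Mem Lk Cv) :=
  σ.foldl (fun X a => {s'' | ∃ s' ∈ X, Step P s' a s''}) {s}

/-- The set of states that `σ` can reach from the initial state. -/
def runStates (P : Program L Mem Lk Cv) (σ : List (Action L Mem Lk Cv)) :
    Set (State L Mem Lk Cv) :=
  statesFrom P P.init σ

/-- `s` is reached by some run (a sequence that reaches no state contributes nothing). -/
def Reachable (P : Program L Mem Lk Cv) (s : State L Mem Lk Cv) : Prop :=
  ∃ σ, s ∈ runStates P σ

/-- `a` commutes with `a'` at the state `s`. -/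
def CommutesAt (P : Program L Mem Lk Cv) (s : State L Mem Lk Cv)
    (a a' : Action L Mem Lk Cv) : Prop :=
  (∀ s', Step P s a s' → (Enabled P s a' ↔ Enabled P s' a')) ∧
  (Enabled P s a → Enabled P s a' → statesFrom P s [a, a'] = statesFrom P s [a', a])

/-- Local actions of different threads commute at every reachable state. -/
def Program.DataRaceFree (P : Program L Mem Lk Cv) : Prop :=
  ∀ (i i' : Thread) (t t' : Stmt L Mem Lk Cv), i ≠ i' →
    ∀ s, Reachable P s → CommutesAt P s ⟨i, .loc t⟩ ⟨i', .loc t'⟩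

/-- If two different actions of one thread are enabled after a run (each of them at some state
that the run can reach), then both are local, or both are signals on the same condition
variable (which may differ in the thread that they wake up). -/
def Program.WellFormed (P : Program L Mem Lk Cv) : Prop :=
  ∀ (σ : List (Action L Mem Lk Cv)) (i : Thread) (b b' : Effect L Mem Lk Cv),
    EnabledAt P (runStates P σ) ⟨i, b⟩ → EnabledAt P (runStates P σ) ⟨i, b'⟩ → b ≠ b' →
      (∃ t t', b = .loc t ∧ b' = .loc t') ∨ (∃ c k k', b = .sig c k ∧ b' = .sig c k')

/-- A thread that waits on a condition variable, or has been woken up but has not resumed yet,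
can only perform an action of `w2` effect (that is, a `w1` action of a thread is followed, in
that thread, by the corresponding `w2` action). -/
def Program.WaitBlocks (P : Program L Mem Lk Cv) : Prop :=
  ∀ s, Reachable P s → ∀ (i : Thread) (c : Cv),
    (((i : ℕ) : ℤ) ∈ s.v c ∨ -((i : ℕ) : ℤ) ∈ s.v c) →
      ∀ b, Enabled P s ⟨i, b⟩ → ∃ c' l, b = .w2 c' l

/-! ### Dependence -/

/-- `DepRow i b j b'`: the action `⟨j, b'⟩` is listed among the actions that depend on
`⟨i, b⟩`. -/
def DepRow (i : Thread) (b : Effect L Mem Lk Cv) (j : Thread) (b' : Effect L Mem Lk Cv) : Prop :=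
  match b with
  | .loc _ => False
  | .acq l => b' = .acq l ∨ b' = .rel l ∨ ∃ c, b' = .w1 c l ∨ b' = .w2 c l
  | .rel l => b' = .acq l ∨ b' = .rel l ∨ ∃ c, b' = .w1 c l ∨ b' = .w2 c l
  | .w1 c l =>
      b' = .acq l ∨ b' = .rel l ∨ (∃ c', b' = .w1 c' l ∨ b' = .w2 c' l) ∨
      b' = .sig c 0 ∨ b' = .sig c (i : ℕ) ∨ ∃ W, b' = .bro c W
  | .w2 c l =>
      b' = .acq l ∨ b' = .rel l ∨ (∃ c', b' = .w1 c' l ∨ b' = .w2 c' l) ∨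
      b' = .sig c (i : ℕ) ∨ ∃ W, i ∈ W ∧ b' = .bro c W
  | .sig c k =>
      (k ≠ 0 ∧
        ((∃ l, (j : ℕ) = k ∧ (b' = .w1 c l ∨ b' = .w2 c l)) ∨
          b' = .sig c 0 ∨ b' = .sig c k ∨ ∃ W, b' = .bro c W)) ∨
      (k = 0 ∧
        ((∃ l, b' = .w1 c l) ∨ (∃ k', 1 ≤ k' ∧ b' = .sig c k') ∨
          ∃ W, W ≠ ∅ ∧ b' = .bro c W))
  | .bro c W =>
      (W = ∅ ∧
        ((∃ l, b' = .w1 c l) ∨ (∃ k', 1 ≤ k' ∧ b' = .sig c k') ∨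
          ∃ W', W' ≠ ∅ ∧ b' = .bro c W')) ∨
      (W ≠ ∅ ∧
        ((∃ l, b' = .w1 c l) ∨ (∃ l, j ∈ W ∧ b' = .w2 c l) ∨
          (∃ k', b' = .sig c k') ∨ ∃ W', b' = .bro c W'))

/-- The dependence relation on actions; independence is its complement. -/
def Dep (a a' : Action L Mem Lk Cv) : Prop :=
  a.thread = a'.thread ∨ DepRow a.thread a.effect a'.thread a'.effect ∨
    DepRow a'.thread a'.effect a.thread a.effect

end Semantics

/-! ### Canonical names of events

The type `Name A` is the initial algebra of `X ↦ A × Finset X`: its elements are exactly the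
pairs of an action and a finite set of elements of `Name A`, formed inductively. -/

/-- The functor `X ↦ A × Finset X`. -/
def NameF (A X : Type u) := A × Finset X

instance (A : Type u) : QPF (NameF A) where
  map f x := (x.1, x.2.image f)
  P := ⟨A × ℕ, fun x => ULift.{u} (Fin x.2)⟩
  abs x := (x.1.1, Finset.univ.image x.2)
  repr x := ⟨(x.1, x.2.card), fun k => (x.2.equivFin.symm k.down : _)⟩
  abs_repr := by
    rintro α ⟨a, s⟩
    refine Prod.ext rfl (Finset.ext fun y => ?_)
    simp only [Finset.mem_image, Finset.mem_univ, true_and]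
    constructor
    · rintro ⟨k, rfl⟩
      exact (s.equivFin.symm k.down).2
    · intro hy
      exact ⟨⟨s.equivFin ⟨y, hy⟩⟩, by simp⟩
  abs_map := by
    rintro α β f ⟨a, g⟩
    refine Prod.ext rfl (Finset.ext fun y => ?_)
    constructor
    · intro hy
      obtain ⟨k, -, rfl⟩ := Finset.mem_image.1 hy
      exact Finset.mem_image_of_mem f (Finset.mem_image_of_mem g (Finset.mem_univ k))
    · intro hy
      obtain ⟨x, hx, rfl⟩ := Finset.mem_image.1 hy
      obtain ⟨k, -, rfl⟩ := Finset.mem_image.1 hx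
      exact Finset.mem_image.2 ⟨k, Finset.mem_univ k, rfl⟩

/-- Canonical names `⟨a, H⟩` of events: an action and a finite set of names. -/
def Name (A : Type u) := QPF.Fix (NameF A)

section Names

variable {A : Type u}

/-- The name `⟨a, H⟩`. -/
def Name.mk (a : A) (H : Finset (Name A)) : Name A := QPF.Fix.mk (F := NameF A) (a, H)

/-- The label `h(e)` of `e = ⟨a, H⟩`, that is, `a`. -/
def Name.label (e : Name A) : A := (QPF.Fix.dest (F := NameF A) e).1

/-- The causes of `e = ⟨a, H⟩`, that is, `H`. The relation `e' < e` is `e' ∈ e.causes`. -/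
def Name.causes (e : Name A) : Finset (Name A) := (QPF.Fix.dest (F := NameF A) e).2

@[simp] theorem Name.label_mk (a : A) (H : Finset (Name A)) : (Name.mk a H).label = a :=
  congrArg Prod.fst (QPF.Fix.dest_mk (F := NameF A) (a, H))

@[simp] theorem Name.causes_mk (a : A) (H : Finset (Name A)) : (Name.mk a H).causes = H :=
  congrArg Prod.snd (QPF.Fix.dest_mk (F := NameF A) (a, H))

@[simp] theorem Name.mk_label_causes (e : Name A) : Name.mk e.label e.causes = e :=
  QPF.Fix.mk_dest (F := NameF A) e

theorem Name.induction {p : Name A → Prop}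
    (h : ∀ a H, (∀ e ∈ H, p e) → p (Name.mk a H)) (e : Name A) : p e := by
  refine QPF.Fix.ind (F := NameF A) p (fun x hx => ?_) e
  obtain ⟨⟨a, u⟩, rfl⟩ := hx
  refine h a _ fun e he => ?_
  obtain ⟨y, -, rfl⟩ := Finset.mem_image.1 he
  exact y.2

/-- The local configuration `[e]`. -/
def Name.localConf (e : Name A) : Finset (Name A) := insert e e.causes

/-- `C` contains the causes of each of its elements. -/
def CausallyClosed (C : Finset (Name A)) : Prop := ∀ e ∈ C, e.causes ⊆ C

/-- The union `[M]` of the local configurations of the elements of `M`. -/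
def localConfs (M : Finset (Name A)) : Finset (Name A) := M.biUnion Name.localConf

/-- The interleavings of `C`: the label sequences of its enumerations that respect causality. -/
def interleavings (C : Finset (Name A)) : Set (List A) :=
  {σ | ∃ es : List (Name A), es.Nodup ∧ (∀ e, e ∈ es ↔ e ∈ C) ∧
    es.Pairwise (fun e e' => e' ∉ e.causes) ∧ σ = es.map Name.label}

/-- No two elements of `S` are causally related. -/
def Concurrent (S : Finset (Name A)) : Prop := ∀ e ∈ S, ∀ e' ∈ S, e ∉ e'.causes

end Names

/-! ### The unfolding -/

/-- Names over the actions of a program. -/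
abbrev Ev (L Mem Lk Cv : Type*) := Name (Action L Mem Lk Cv)

section Unfolding

variable {L Mem Lk Cv : Type*}

/-- The conflict relation of the unfolding. -/
def Conflict (e e' : Ev L Mem Lk Cv) : Prop :=
  e ≠ e' ∧ e ∉ e'.causes ∧ e' ∉ e.causes ∧ Dep e.label e'.label

/-- No two elements of `C` are in conflict. -/
def ConflictFree (C : Finset (Ev L Mem Lk Cv)) : Prop := ∀ e ∈ C, ∀ e' ∈ C, ¬ Conflict e e'

/-- `state(C)`: the states reached by the interleavings of `C`. (In a data-race-free program all
interleavings of a configuration reach the same set of states, so that any of them may be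
taken.) -/
def configStates (P : Program L Mem Lk Cv) (C : Finset (Ev L Mem Lk Cv)) :
    Set (State L Mem Lk Cv) :=
  {s | ∃ σ ∈ interleavings C, s ∈ runStates P σ}

/-- The events of the unfolding of `P`, generated from below: `⟨a, C⟩` is an event if `C` is a
configuration (of events), `a` is enabled at `state(C)` and `a` depends on the label of every
causally maximal event of `C`. -/
inductive IsEvent (P : Program L Mem Lk Cv) : Ev L Mem Lk Cv → Prop
  | intro (a : Action L Mem Lk Cv) (C : Finset (Ev L Mem Lk Cv))
      (events : ∀ e ∈ C, IsEvent P e) (closed : CausallyClosed C) (free : ConflictFree C)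
      (enabled : EnabledAt P (configStates P C) a)
      (dep : ∀ e ∈ C, (∀ e' ∈ C, e ∉ e'.causes) → Dep a e.label) :
      IsEvent P (Name.mk a C)

/-- Configurations of the unfolding of `P`. -/
def IsConfiguration (P : Program L Mem Lk Cv) (C : Finset (Ev L Mem Lk Cv)) : Prop :=
  (∀ e ∈ C, IsEvent P e) ∧ CausallyClosed C ∧ ConflictFree C

/-- The extensions of `C`. -/
def extensions (P : Program L Mem Lk Cv) (C : Finset (Ev L Mem Lk Cv)) :
    Set (Ev L Mem Lk Cv) :=
  {e | IsEvent P e ∧ e ∉ C ∧ e.causes ⊆ C}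

/-- The enabled events of `C`. -/
def enabledEvents (P : Program L Mem Lk Cv) (C : Finset (Ev L Mem Lk Cv)) :
    Set (Ev L Mem Lk Cv) :=
  {e | e ∈ extensions P C ∧ IsConfiguration P (insert e C)}

/-- The conflicting extensions of `C`. -/
def cex (P : Program L Mem Lk Cv) (C : Finset (Ev L Mem Lk Cv)) : Set (Ev L Mem Lk Cv) :=
  extensions P C \ enabledEvents P C

/-- Configurations that some run of `P` executes. -/
def IsRunConfiguration (P : Program L Mem Lk Cv) (C : Finset (Ev L Mem Lk Cv)) : Prop :=
  IsConfiguration P C ∧ (configStates P C).Nonempty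

/-- The event has `w1` effect. -/
def IsW1 (e : Ev L Mem Lk Cv) : Prop := ∃ c l, e.label.effect = .w1 c l

/-! ### The procedure for events of `w1` effect -/

/-- The causally maximal event of thread `i` in `C`, if there is one. -/
def lastOf (C : Finset (Ev L Mem Lk Cv)) (i : Thread) : Option (Ev L Mem Lk Cv) :=
  if h : ∃ e ∈ C, e.label.thread = i ∧ ∀ e' ∈ C, e'.label.thread = i → e ∉ e'.causes then
    some h.choose
  else none

/-- `[e_t]`, where `e_t` is the last event of thread `i` in `K`. -/
def threadPast (K : Finset (Ev L Mem Lk Cv)) (i : Thread) : Finset (Ev L Mem Lk Cv) :=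
  (lastOf K i).elim ∅ Name.localConf

/-- The events of `X` that are lost signals on `c`, lost broadcasts on `c`, or broadcasts on `c`
that do not wake up thread `i`. -/
def lostNotifications (X : Finset (Ev L Mem Lk Cv)) (c : Cv) (i : Thread) :
    Finset (Ev L Mem Lk Cv) :=
  X.filter fun e =>
    e.label.effect = .sig c 0 ∨ e.label.effect = .bro c ∅ ∨
      ∃ S : Set Thread, i ∉ S ∧ e.label.effect = .bro c S

/-- The set that the procedure returns on an event `e = ⟨⟨i, w1 c l⟩, K⟩`. -/
def cexWait (e : Ev L Mem Lk Cv) : Set (Ev L Mem Lk Cv) :=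
  match e.label with
  | ⟨i, .w1 c _⟩ =>
      {e' | ∃ M : Finset (Ev L Mem Lk Cv),
        M ⊆ lostNotifications (e.causes \ threadPast e.causes i) c i ∧ Concurrent M ∧
        localConfs M ∪ threadPast e.causes i ≠ e.causes ∧
        e' = Name.mk e.label (localConfs M ∪ threadPast e.causes i)}
  | _ => ∅

end Unfolding

end Unf

end

noncomputable section

open scoped Classical

universe u

namespace Unf

/-! ### Transitions, their exchange, and runs -/

section Transitions

variable {L Mem Lk Cv : Type*}

/-! A `w1` action of thread `i` on `l` is enabled exactly when `i` holds `l` and stands at a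
matching wait statement. Other threads change neither fact, so enabledness of `w1` after a
configuration depends only on its events of `i` (`enabledAt_w1_of_superset`,
`enabledAt_w1_of_subset`). This uses that all interleavings of a configuration reach the same states
(`mem_configStates_iff`), which comes from exchanging adjacent independent transitions
(`Step.swap`).

Let the procedure return `e'` on `e`. The causes of `e'` keep all events of `i` below `e`, so the
action is still enabled; the maximal ones belong to `i` or to `M`, so the action depends on them and
`e'` is an event. It differs from `e`, has the same thread, and neither causes the other: it
conflicts with `e`.

Conversely, let `e'` be a `w1` extension of `C`. If all events of `i` in `C` were causes of `e'`,
the action would be enabled after `C` and `C` could be enlarged. So take a minimal event `e` of `i`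
in `C` outside the causes of `e'`. After the union of both sets of causes, the labels of `e` and
`e'` are both enabled, and well-formedness makes them equal (`exists_w1_event`). Every cause of `e'`
on which the action depends is ordered with `e`, hence below it; so both events have the same thread
past. A maximal cause of `e'` in another thread is a lost signal or a broadcast that spares `i`,
since any other dependent action leaves a state where `w1` is disabled (`lost_of_maximal`). The
maximal causes outside the thread past form `M`. -/

/-- The part of a transition that concerns the location of the thread and the memory. -/
def PStep (P : Program L Mem Lk Cv) (i : Thread) (b : Effect L Mem Lk Cv)
    (n : L) (m : Mem) (n' : L) (m' : Mem) : Prop :=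
  match b with
  | .loc t => ∃ r, t = ⟨i, n, n', .loc, r⟩ ∧ t ∈ P.stmts ∧ (m, m') ∈ r
  | .acq l => m' = m ∧ ∃ r, ⟨i, n, n', .lock l, r⟩ ∈ P.stmts
  | .rel l => m' = m ∧ ∃ r, ⟨i, n, n', .unlock l, r⟩ ∈ P.stmts
  | .w1 c l => m' = m ∧ n' = n ∧ ∃ n'' r, ⟨i, n, n'', .wait c l, r⟩ ∈ P.stmts
  | .w2 c l => m' = m ∧ ∃ r, ⟨i, n, n', .wait c l, r⟩ ∈ P.stmts
  | .sig c _ => m' = m ∧ ∃ r, ⟨i, n, n', .signal c, r⟩ ∈ P.stmts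
  | .bro c _ => m' = m ∧ ∃ r, ⟨i, n, n', .bcast c, r⟩ ∈ P.stmts

/-- The part of a transition that concerns the mutexes. -/
def UStep (i : Thread) (b : Effect L Mem Lk Cv) (u u' : Lk → ℕ) : Prop :=
  match b with
  | .acq l => u l = 0 ∧ u' = Function.update u l (i : ℕ)
  | .rel l => u l = (i : ℕ) ∧ u' = Function.update u l 0
  | .w1 _ l => u l = (i : ℕ) ∧ u' = Function.update u l 0
  | .w2 _ l => u l = 0 ∧ u' = Function.update u l (i : ℕ)
  | _ => u' = u

/-- The condition variable that an effect accesses. -/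
def Effect.cv : Effect L Mem Lk Cv → Option Cv
  | .w1 c _ => some c
  | .w2 c _ => some c
  | .sig c _ => some c
  | .bro c _ => some c
  | _ => none

/-- The change of the set `v c`, where `c` is the condition variable that the effect accesses. -/
def WStep (i : Thread) (b : Effect L Mem Lk Cv) (S S' : Set ℤ) : Prop :=
  match b with
  | .w1 _ _ => S' = S ∪ {((i : ℕ) : ℤ)}
  | .w2 _ _ => -((i : ℕ) : ℤ) ∈ S ∧ S' = S \ {-((i : ℕ) : ℤ)}
  | .sig _ k => (k = 0 ∧ (∀ j ∈ S, ¬ 0 < j) ∧ S' = S) ∨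
      (k ≠ 0 ∧ (k : ℤ) ∈ S ∧ S' = (S \ {(k : ℤ)}) ∪ {-(k : ℤ)})
  | .bro _ W => W = {j : Thread | ((j : ℕ) : ℤ) ∈ S} ∧
      S' = (S \ {z | ∃ j ∈ W, z = ((j : ℕ) : ℤ)}) ∪ {z | ∃ j ∈ W, z = -((j : ℕ) : ℤ)}
  | _ => S' = S

/-- The part of a transition that concerns the condition variables. -/
def VStep (i : Thread) (b : Effect L Mem Lk Cv) (v v' : Cv → Set ℤ) : Prop :=
  match b.cv with
  | none => v' = v
  | some c => ∃ S', WStep i b (v c) S' ∧ v' = Function.update v c S'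

/-- Every rule is a conjunction of conditions on separate components of the state, so exchange and
frame properties can be proved one component at a time. -/
theorem step_iff {P : Program L Mem Lk Cv} {s s' : State L Mem Lk Cv} {i : Thread}
    {b : Effect L Mem Lk Cv} :
    Step P s ⟨i, b⟩ s' ↔ ∃ n', PStep P i b (s.p i) s.m n' s'.m ∧
      s'.p = Function.update s.p i n' ∧ UStep i b s.u s'.u ∧ VStep i b s.v s'.v := by
  constructor
  · intro h
    cases h with
    | loc p m m' u v i n n' r ht hp hr =>
      exact ⟨n', ⟨r, by simp [hp], ht, hr⟩, rfl, rfl, rfl⟩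
    | acq p m u v i n n' l r ht hp hu =>
      subst hp; exact ⟨n', ⟨rfl, r, ht⟩, rfl, ⟨hu, rfl⟩, rfl⟩
    | rel p m u v i n n' l r ht hp hu =>
      subst hp; exact ⟨n', ⟨rfl, r, ht⟩, rfl, ⟨hu, rfl⟩, rfl⟩
    | w1 p m u v i n n' c l r ht hp hu =>
      subst hp
      -- `w1` does not move the thread: the new location is the old one, and `n'` is only the target
      -- of the statement.
      exact ⟨p i, ⟨rfl, rfl, n', r, ht⟩, by simp, ⟨hu, rfl⟩, _, rfl, rfl⟩
    | w2 p m u v i n n' c l r ht hp hu hv =>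
      subst hp; exact ⟨n', ⟨rfl, r, ht⟩, rfl, ⟨hu, rfl⟩, _, ⟨hv, rfl⟩, rfl⟩
    | sig p m u v i n n' c r j ht hp hv =>
      subst hp
      exact ⟨n', ⟨rfl, r, ht⟩, rfl, rfl, _, Or.inr ⟨j.ne_zero, hv, rfl⟩, rfl⟩
    | sigLost p m u v i n n' c r ht hp hv =>
      subst hp
      exact ⟨n', ⟨rfl, r, ht⟩, rfl, rfl, _, Or.inl ⟨rfl, hv, rfl⟩, by simp⟩
    | bro p m u v i n n' c r W ht hp hW =>
      subst hp; exact ⟨n', ⟨rfl, r, ht⟩, rfl, rfl, _, ⟨hW, rfl⟩, rfl⟩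
  · rintro ⟨n', hP, hp, hU, hV⟩
    obtain ⟨p, m, u, v⟩ := s
    obtain ⟨p', m', u', v'⟩ := s'
    dsimp only at hP hp hU hV
    subst hp
    cases b with
    | loc t =>
      obtain ⟨r, rfl, ht, hr⟩ := hP
      obtain rfl : u' = u := hU
      obtain rfl : v' = v := hV
      exact .loc _ _ _ _ _ _ _ _ _ ht rfl hr
    | acq l =>
      obtain ⟨rfl, r, ht⟩ := hP
      obtain ⟨hu, rfl⟩ := hU
      obtain rfl : v' = v := hV
      exact .acq _ _ _ _ _ _ _ _ _ ht rfl hu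
    | rel l =>
      obtain ⟨rfl, r, ht⟩ := hP
      obtain ⟨hu, rfl⟩ := hU
      obtain rfl : v' = v := hV
      exact .rel _ _ _ _ _ _ _ _ _ ht rfl hu
    | w1 c l =>
      obtain ⟨rfl, rfl, n'', r, ht⟩ := hP
      obtain ⟨hu, rfl⟩ := hU
      obtain ⟨_, rfl, rfl⟩ := hV
      rw [Function.update_eq_self]
      exact .w1 _ _ _ _ _ _ _ _ _ _ ht rfl hu
    | w2 c l =>
      obtain ⟨rfl, r, ht⟩ := hP
      obtain ⟨hu, rfl⟩ := hU
      obtain ⟨_, ⟨hv, rfl⟩, rfl⟩ := hV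
      exact .w2 _ _ _ _ _ _ _ _ _ _ ht rfl hu hv
    | sig c k =>
      obtain ⟨rfl, r, ht⟩ := hP
      obtain rfl : u' = u := hU
      obtain ⟨_, ⟨rfl, hv, rfl⟩ | ⟨hk, hv, rfl⟩, rfl⟩ := hV
      · rw [show Function.update v c (v c) = v by simp]
        exact .sigLost _ _ _ _ _ _ _ _ _ ht rfl hv
      · exact .sig _ _ _ _ _ _ _ _ _ ⟨k, Nat.pos_of_ne_zero hk⟩ ht rfl hv
    | bro c W =>
      obtain ⟨rfl, r, ht⟩ := hP
      obtain rfl : u' = u := hU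
      obtain ⟨_, ⟨hW, rfl⟩, rfl⟩ := hV
      exact .bro _ _ _ _ _ _ _ _ _ _ ht rfl hW

theorem Dep.symm {a a' : Action L Mem Lk Cv} (h : Dep a a') : Dep a' a := by
  rcases h with h | h | h
  exacts [.inl h.symm, .inr (.inr h), .inr (.inl h)]

/-- Independent effects of different threads act on the mutexes in either order. -/
theorem UStep.swap {i i' : Thread} {b b' : Effect L Mem Lk Cv} {u u₁ u₂ : Lk → ℕ}
    (hd : ¬ Dep ⟨i, b⟩ ⟨i', b'⟩) (h : UStep i b u u₁) (h' : UStep i' b' u₁ u₂) :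
    ∃ u₁', UStep i' b' u u₁' ∧ UStep i b u₁' u₂ := by
  cases b <;> cases b' <;>
    simp only [UStep, Dep, DepRow, not_or] at hd h h' ⊢ <;>
    first
    | (subst h; exact ⟨_, h', rfl⟩)
    | (subst h'; exact ⟨_, rfl, h⟩)
    | (obtain ⟨h, rfl⟩ := h
       obtain ⟨h', rfl⟩ := h'
       rename_i l l'
       have hl : l' ≠ l := by rintro rfl; simp at hd
       rw [Function.update_of_ne hl] at h'
       exact ⟨_, ⟨h', rfl⟩, by rwa [Function.update_of_ne hl.symm],
         Function.update_comm hl.symm _ _ _⟩)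
    | (obtain ⟨h, rfl⟩ := h
       obtain ⟨h', rfl⟩ := h'
       rename_i l _ l'
       have hl : l' ≠ l := by rintro rfl; simp at hd
       rw [Function.update_of_ne hl] at h'
       exact ⟨_, ⟨h', rfl⟩, by rwa [Function.update_of_ne hl.symm],
         Function.update_comm hl.symm _ _ _⟩)

/-- Independent effects of different threads on one condition variable act in either order. -/
theorem WStep.swap {i i' : Thread} {b b' : Effect L Mem Lk Cv} {S S₁ S₂ : Set ℤ} {c : Cv}
    (hc : b.cv = some c) (hc' : b'.cv = some c)
    (hd : ¬ Dep ⟨i, b⟩ ⟨i', b'⟩) (h : WStep i b S S₁) (h' : WStep i' b' S₁ S₂) :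
    ∃ S₁', WStep i' b' S S₁' ∧ WStep i b S₁' S₂ := by
  -- Positivity keeps waiting entries apart from negated, woken ones.
  have hi := i.pos
  have hi' := i'.pos
  have hii : (i : ℕ) ≠ i' := fun h => hd (.inl (PNat.coe_injective h))
  cases b <;> simp only [Effect.cv, Option.some.injEq, reduceCtorEq] at hc <;> subst hc <;>
    cases b' <;> simp only [Effect.cv, Option.some.injEq, reduceCtorEq] at hc' <;> subst hc' <;>
    simp only [WStep, Dep, DepRow, not_or] at hd h h' ⊢
  case w1.w1 =>
    subst h h'
    exact ⟨_, rfl, Set.union_right_comm _ _ _⟩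
  case w1.w2 =>
    obtain ⟨hv, rfl⟩ := h'
    subst h
    refine ⟨_, ⟨?_, rfl⟩, ?_⟩
    · grind
    · ext z; simp; grind
  case w1.sig =>
    subst h
    simp at hd
    obtain ⟨rfl, hv, rfl⟩ | ⟨hk, hv, rfl⟩ := h'
    · simp at hd
    · refine ⟨_, .inr ⟨hk, ?_, rfl⟩, ?_⟩
      · grind
      · ext z; simp; grind
  case w1.bro => simp at hd
  case w2.w1 =>
    subst h'
    obtain ⟨hv, rfl⟩ := h
    refine ⟨_, rfl, ?_, ?_⟩
    · simp [hv]
    · ext z; simp; grind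
  case w2.w2 =>
    obtain ⟨hv, rfl⟩ := h
    obtain ⟨hv', rfl⟩ := h'
    refine ⟨_, ⟨hv'.1, rfl⟩, ⟨hv, by grind⟩, ?_⟩
    ext z; simp; grind
  case w2.sig =>
    obtain ⟨hv, rfl⟩ := h
    obtain ⟨rfl, hv', rfl⟩ | ⟨hk, hv', rfl⟩ := h'
    · refine ⟨_, .inl ⟨rfl, fun j hj hj' => hv' j ⟨hj, by grind⟩ hj', rfl⟩, hv, rfl⟩
    · simp at hd
      refine ⟨_, .inr ⟨hk, hv'.1, rfl⟩, ⟨.inl ⟨hv, by grind⟩, ?_⟩⟩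
      ext z; simp; grind
  case w2.bro =>
    obtain ⟨hv, rfl⟩ := h
    obtain ⟨rfl, rfl⟩ := h'
    have hpos : {j : Thread | ((j : ℕ) : ℤ) ∈ S \ {-((i : ℕ) : ℤ)}} =
        {j : Thread | ((j : ℕ) : ℤ) ∈ S} := by
      ext j; simp
    rw [hpos] at hd ⊢
    -- Otherwise the broadcast wakes `i` and the effects are dependent; hence it does not create the
    -- entry `-i` that `w2` removes.
    have hiS : ((i : ℕ) : ℤ) ∉ S := by
      intro hi
      simp at hd
      exact hd.2.2 (Set.nonempty_iff_ne_empty.1 ⟨i, hi⟩) hi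
    refine ⟨_, ⟨rfl, rfl⟩, ⟨.inl ⟨hv, ?_⟩, ?_⟩⟩
    · rintro ⟨j, -, hj⟩; grind
    · ext z; simp; grind
  case sig.w1 =>
    subst h'
    simp at hd
    obtain ⟨rfl, hv, rfl⟩ | ⟨hk, hv, rfl⟩ := h
    · simp at hd
    · refine ⟨_, rfl, .inr ⟨hk, .inl hv, ?_⟩⟩
      ext z; simp; grind
  case sig.w2 =>
    obtain ⟨hv', rfl⟩ := h'
    simp at hd
    obtain ⟨rfl, hv, rfl⟩ | ⟨hk, hv, rfl⟩ := h
    · exact ⟨_, ⟨hv', rfl⟩, .inl ⟨rfl, fun j hj => hv j hj.1, rfl⟩⟩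
    · refine ⟨_, ⟨?_, rfl⟩, .inr ⟨hk, ⟨hv, by grind⟩, ?_⟩⟩
      · grind
      · ext z; simp; grind
  case sig.sig =>
    simp at hd
    obtain ⟨rfl, hv, rfl⟩ | ⟨hk, hv, rfl⟩ := h <;>
      obtain ⟨rfl, hv', rfl⟩ | ⟨hk', hv', rfl⟩ := h'
    · exact ⟨_, .inl ⟨rfl, hv, rfl⟩, .inl ⟨rfl, hv, rfl⟩⟩
    · grind
    · grind
    · refine ⟨_, .inr ⟨hk', ?_, rfl⟩, .inr ⟨hk, .inl ⟨hv, by grind⟩, ?_⟩⟩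
      · grind
      · ext z; simp; grind
  case sig.bro =>
    obtain ⟨rfl, rfl⟩ := h'
    simp at hd
    obtain ⟨rfl, hv, rfl⟩ | ⟨hk, hv, rfl⟩ := h
    · exact ⟨_, ⟨rfl, rfl⟩, .inl ⟨rfl, by grind, by grind⟩⟩
    · grind
  case bro.w1 => simp at hd
  case bro.w2 =>
    obtain ⟨rfl, rfl⟩ := h
    obtain ⟨hv, rfl⟩ := h'
    have hiS : ((i' : ℕ) : ℤ) ∉ S := by
      intro hi
      simp at hd
      grind
    have hv' : -((i' : ℕ) : ℤ) ∈ S := by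
      simp at hv
      grind
    have hpos : {j : Thread | ((j : ℕ) : ℤ) ∈ S \ {-((i' : ℕ) : ℤ)}} =
        {j : Thread | ((j : ℕ) : ℤ) ∈ S} := by
      ext j; simp
    refine ⟨_, ⟨hv', rfl⟩, ⟨hpos.symm, ?_⟩⟩
    ext z; simp; grind
  case bro.sig =>
    obtain ⟨rfl, rfl⟩ := h
    simp at hd
    obtain ⟨rfl, hv, rfl⟩ | ⟨hk, hv, rfl⟩ := h'
    · have : {j : Thread | ((j : ℕ) : ℤ) ∈ S} = ∅ := by grind
      refine ⟨_, .inl ⟨rfl, fun j hj hj' => ?_, rfl⟩, rfl, rfl⟩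
      have hmem : (⟨j.toNat, by omega⟩ : Thread) ∈ {j : Thread | ((j : ℕ) : ℤ) ∈ S} := by
        change ((j.toNat : ℕ) : ℤ) ∈ S
        rwa [Int.toNat_of_nonneg hj'.le]
      rw [this] at hmem
      exact hmem
    · grind
  case bro.bro W _ W' =>
    obtain ⟨h, rfl⟩ := h
    obtain ⟨h', rfl⟩ := h'
    have hW : W = ∅ := by
      by_contra hW
      exact hd.2.1.2 ⟨hW, .inr (.inr (.inr ⟨W', rfl⟩))⟩
    have hW' : W' = ∅ := by
      by_contra hW'
      exact hd.2.2.2 ⟨hW', .inr (.inr (.inr ⟨W, rfl⟩))⟩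
    subst hW hW'
    simp only [Set.mem_empty_iff_false, false_and, exists_false, Set.ofPred_false, Set.sdiff_empty,
      Set.union_empty]
    exact ⟨_, ⟨h, rfl⟩, h, rfl⟩

/-- Independent effects of different threads act on the condition variables in either order. -/
theorem VStep.swap {i i' : Thread} {b b' : Effect L Mem Lk Cv} {v v₁ v₂ : Cv → Set ℤ}
    (hd : ¬ Dep ⟨i, b⟩ ⟨i', b'⟩) (h : VStep i b v v₁) (h' : VStep i' b' v₁ v₂) :
    ∃ v₁', VStep i' b' v v₁' ∧ VStep i b v₁' v₂ := by
  unfold VStep at *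
  rcases hc : b.cv with _ | c <;> rcases hc' : b'.cv with _ | c' <;>
    simp only [hc, hc'] at h h' ⊢
  · subst h; exact ⟨_, h', rfl⟩
  · subst h; exact ⟨_, h', rfl⟩
  · subst h'; exact ⟨_, rfl, h⟩
  · obtain ⟨S, hS, rfl⟩ := h
    obtain ⟨S', hS', rfl⟩ := h'
    by_cases hcc : c' = c
    · subst hcc
      rw [Function.update_self] at hS'
      obtain ⟨S₁, h₁, h₂⟩ := hS.swap hc hc' hd hS'
      exact ⟨_, ⟨S₁, h₁, rfl⟩, S', by simpa using h₂, by simp⟩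
    · rw [Function.update_of_ne hcc] at hS'
      exact ⟨_, ⟨S', hS', rfl⟩, S, by rwa [Function.update_of_ne (Ne.symm hcc)],
        Function.update_comm (Ne.symm hcc) _ _ _⟩

/-- The guards let `j` only take a free mutex or release its own, so a changed entry is `0` or `j`
both before and after, never `i`. -/
theorem UStep.held_iff {i j : Thread} {b : Effect L Mem Lk Cv} {u u' : Lk → ℕ}
    (h : UStep j b u u') (hji : j ≠ i) (l : Lk) : u' l = (i : ℕ) ↔ u l = (i : ℕ) := by
  have hji' : (j : ℕ) ≠ i := fun h => hji (PNat.coe_injective h)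
  have hi := i.ne_zero
  cases b <;> simp only [UStep] at h
  case loc => rw [h]
  case sig => rw [h]
  case bro => rw [h]
  all_goals
    obtain ⟨h, rfl⟩ := h
    rename_i l'
    by_cases hl : l = l'
    · subst hl
      rw [Function.update_self]
      omega
    · rw [Function.update_of_ne hl]

/-- The memory is changed by local actions only. -/
theorem PStep.mem_eq {P : Program L Mem Lk Cv} {i : Thread} {b : Effect L Mem Lk Cv} {n n' : L}
    {m m' : Mem} (h : PStep P i b n m n' m') (hb : ∀ t, b ≠ .loc t) : m' = m := by
  cases b <;> first | exact h.1 | exact absurd rfl (hb _)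

theorem PStep.change_mem {P : Program L Mem Lk Cv} {i : Thread} {b : Effect L Mem Lk Cv}
    {n n' : L} {m m' : Mem} (h : PStep P i b n m n' m') (hb : ∀ t, b ≠ .loc t) (m'' : Mem) :
    PStep P i b n m'' n' m'' := by
  cases b <;> first | exact ⟨rfl, h.2⟩ | exact absurd rfl (hb _)

/-! ### Runs -/

theorem mem_foldl_steps {P : Program L Mem Lk Cv} (σ : List (Action L Mem Lk Cv))
    (X : Set (State L Mem Lk Cv)) (t : State L Mem Lk Cv) :
    t ∈ σ.foldl (fun X a => {s'' | ∃ s' ∈ X, Step P s' a s''}) X ↔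
      ∃ s ∈ X, t ∈ statesFrom P s σ := by
  unfold statesFrom
  induction σ generalizing X with
  | nil => simp
  | cons a σ ih =>
    simp only [List.foldl_cons]
    rw [ih]
    constructor
    · rintro ⟨s', ⟨s, hs, h⟩, ht⟩
      exact ⟨s, hs, (ih _).2 ⟨s', ⟨s, rfl, h⟩, ht⟩⟩
    · rintro ⟨s, hs, ht⟩
      obtain ⟨s', ⟨s₀, hs₀, h⟩, ht'⟩ := (ih _).1 ht
      obtain rfl : s₀ = s := hs₀
      exact ⟨s', ⟨_, hs, h⟩, ht'⟩

@[simp] theorem mem_statesFrom_nil {P : Program L Mem Lk Cv} {s t : State L Mem Lk Cv} :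
    t ∈ statesFrom P s [] ↔ t = s := Iff.rfl

theorem mem_statesFrom_append {P : Program L Mem Lk Cv} {s t : State L Mem Lk Cv}
    {σ τ : List (Action L Mem Lk Cv)} :
    t ∈ statesFrom P s (σ ++ τ) ↔ ∃ s' ∈ statesFrom P s σ, t ∈ statesFrom P s' τ := by
  rw [← mem_foldl_steps]
  simp only [statesFrom, List.foldl_append]

@[simp] theorem mem_statesFrom_singleton {P : Program L Mem Lk Cv} {s t : State L Mem Lk Cv}
    {a : Action L Mem Lk Cv} : t ∈ statesFrom P s [a] ↔ Step P s a t := by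
  simp [statesFrom]

theorem mem_statesFrom_cons {P : Program L Mem Lk Cv} {s t : State L Mem Lk Cv}
    {a : Action L Mem Lk Cv} {σ : List (Action L Mem Lk Cv)} :
    t ∈ statesFrom P s (a :: σ) ↔ ∃ s', Step P s a s' ∧ t ∈ statesFrom P s' σ := by
  rw [← List.singleton_append, mem_statesFrom_append]
  simp

theorem Reachable.of_mem_statesFrom {P : Program L Mem Lk Cv} {s t : State L Mem Lk Cv}
    {σ : List (Action L Mem Lk Cv)} (hs : Reachable P s) (ht : t ∈ statesFrom P s σ) :
    Reachable P t := by
  obtain ⟨τ, hτ⟩ := hs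
  exact ⟨τ ++ σ, mem_statesFrom_append.2 ⟨s, hτ, ht⟩⟩

/-- Consecutive independent transitions can be exchanged. -/
theorem Step.swap {P : Program L Mem Lk Cv} (hdrf : P.DataRaceFree) {s s₁ s₂ : State L Mem Lk Cv}
    {a a' : Action L Mem Lk Cv} (hs : Reachable P s) (hd : ¬ Dep a a')
    (h : Step P s a s₁) (h' : Step P s₁ a' s₂) : ∃ s₁', Step P s a' s₁' ∧ Step P s₁' a s₂ := by
  obtain ⟨i, b⟩ := a
  obtain ⟨i', b'⟩ := a'
  have hii : i ≠ i' := fun h => hd (.inl h)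
  -- Data-race-freeness serves the case of two local effects; otherwise at most one of the two
  -- touches the memory.
  by_cases hloc : (∃ t, b = .loc t) ∧ ∃ t', b' = .loc t'
  · obtain ⟨⟨t, rfl⟩, t', rfl⟩ := hloc
    obtain ⟨hen, hst⟩ := hdrf i i' t t' hii s hs
    have hmem : s₂ ∈ statesFrom P s [⟨i, .loc t⟩, ⟨i', .loc t'⟩] :=
      mem_statesFrom_cons.2 ⟨s₁, h, mem_statesFrom_singleton.2 h'⟩
    rw [hst ⟨_, h⟩ ((hen _ h).2 ⟨_, h'⟩), mem_statesFrom_cons] at hmem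
    simpa using hmem
  · obtain ⟨n, hP, hp, hU, hV⟩ := step_iff.1 h
    obtain ⟨n', hP', hp', hU', hV'⟩ := step_iff.1 h'
    obtain ⟨u, hu, hu'⟩ := hU.swap hd hU'
    obtain ⟨v, hv, hv'⟩ := hV.swap hd hV'
    rw [hp, Function.update_of_ne hii.symm] at hP'
    have key : ∃ m, PStep P i' b' (s.p i') s.m n' m ∧ PStep P i b (s.p i) m n s₂.m := by
      by_cases hb : ∃ t, b = .loc t
      · have hb' : ∀ t, b' ≠ .loc t := fun t ht => hloc ⟨hb, t, ht⟩
        refine ⟨s.m, hP'.change_mem hb' _, ?_⟩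
        rwa [hP'.mem_eq hb']
      · rw [not_exists] at hb
        rw [hP.mem_eq hb] at hP'
        exact ⟨s₂.m, hP', hP.change_mem hb _⟩
    obtain ⟨m, hm, hm'⟩ := key
    refine ⟨⟨Function.update s.p i' n', m, u, v⟩, step_iff.2 ⟨n', hm, rfl, hu, hv⟩,
      step_iff.2 ⟨n, ?_, ?_, hu', hv'⟩⟩
    · simpa only [Function.update_of_ne hii] using hm'
    · rw [hp', hp, Function.update_comm hii.symm]

/-- An action may be moved to the front of a run past actions that are independent of it. -/
theorem statesFrom_move_front {P : Program L Mem Lk Cv} (hdrf : P.DataRaceFree)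
    {s : State L Mem Lk Cv} (hs : Reachable P s) {a : Action L Mem Lk Cv}
    {σ τ : List (Action L Mem Lk Cv)} (hd : ∀ b ∈ σ, ¬ Dep a b) :
    statesFrom P s (σ ++ a :: τ) = statesFrom P s (a :: (σ ++ τ)) := by
  induction σ generalizing s with
  | nil => rfl
  | cons b σ ih =>
    have hb : ¬ Dep a b := hd b (by simp)
    have hσ : ∀ b ∈ σ, ¬ Dep a b := fun b hb => hd b (by simp [hb])
    ext t
    simp only [List.cons_append, mem_statesFrom_cons]
    constructor
    · rintro ⟨s₁, h₁, ht⟩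
      rw [ih (hs.of_mem_statesFrom (mem_statesFrom_singleton.2 h₁)) hσ, mem_statesFrom_cons] at ht
      obtain ⟨s₂, h₂, ht⟩ := ht
      obtain ⟨s', h, h'⟩ := h₁.swap hdrf hs (fun h => hb h.symm) h₂
      exact ⟨s', h, s₂, h', ht⟩
    · rintro ⟨s₁, h₁, s₂, h₂, ht⟩
      obtain ⟨s', h, h'⟩ := h₁.swap hdrf hs hb h₂
      refine ⟨s', h, ?_⟩
      rw [ih (hs.of_mem_statesFrom (mem_statesFrom_singleton.2 h)) hσ, mem_statesFrom_cons]
      exact ⟨s₂, h', ht⟩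

/-- Enumerations of the same events that differ only in the order of independent events reach the
same states. -/
theorem statesFrom_eq_of_perm {P : Program L Mem Lk Cv} (hdrf : P.DataRaceFree)
    {es fs : List (Ev L Mem Lk Cv)} {s : State L Mem Lk Cv} (hs : Reachable P s)
    (hperm : es.Perm fs) (hes : es.Pairwise fun e e' => e' ∉ e.causes)
    (hfs : fs.Pairwise fun e e' => e' ∉ e.causes) (hnd : es.Nodup)
    (hcf : ∀ e ∈ es, ∀ e' ∈ es, ¬ Conflict e e') :
    statesFrom P s (es.map Name.label) = statesFrom P s (fs.map Name.label) := by
  induction fs generalizing es s with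
  | nil => rw [hperm.eq_nil]
  | cons x fs ih =>
    obtain ⟨es₁, es₂, rfl⟩ := List.append_of_mem (hperm.mem_iff.2 (List.mem_cons_self))
    have hperm' : (es₁ ++ es₂).Perm fs := (List.perm_middle.symm.trans hperm).cons_inv
    rw [List.pairwise_append] at hes
    obtain ⟨hes₁, hes₂, hes₁₂⟩ := hes
    rw [List.pairwise_cons] at hes₂ hfs
    have hnd' : (x :: (es₁ ++ es₂)).Nodup := List.perm_middle.nodup_iff.1 hnd
    rw [List.nodup_cons] at hnd'
    -- An event listed before `x` in `es` is not above `x`, and since `x` heads `fs` it is not below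
    -- `x`. Without conflict it is independent of `x`, so `x` can move to the front.
    have hind : ∀ b ∈ es₁.map Name.label, ¬ Dep x.label b := by
      intro b hb hdep
      obtain ⟨y, hy, rfl⟩ := List.mem_map.1 hb
      refine hcf x (by simp) y (by simp [hy]) ⟨?_, hes₁₂ y hy x (by simp), ?_, hdep⟩
      · rintro rfl
        exact hnd'.1 (by simp [hy])
      · exact hfs.1 y (hperm'.mem_iff.1 (by simp [hy]))
    rw [List.map_append, List.map_cons, statesFrom_move_front hdrf hs hind, ← List.map_append]
    ext t
    simp only [List.map_cons, mem_statesFrom_cons]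
    refine exists_congr fun s' => and_congr_right fun h => ?_
    rw [ih (hs.of_mem_statesFrom (mem_statesFrom_singleton.2 h)) hperm' ?_ hfs.2 hnd'.2 ?_]
    · exact List.pairwise_append.2 ⟨hes₁, hes₂.2, fun a ha b hb => hes₁₂ a ha b (by simp [hb])⟩
    · intro e he e' he'
      refine hcf e ?_ e' ?_ <;> simp only [List.mem_append, List.mem_cons] at he he' ⊢ <;> tauto

/-- The possible locations of a thread after a run do not depend on the rest of the state, and
the run determines the mutexes and the condition variables. -/
theorem runStates_exchange {P : Program L Mem Lk Cv} (i : Thread)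
    (σ : List (Action L Mem Lk Cv)) {s t : State L Mem Lk Cv}
    (hs : s ∈ runStates P σ) (ht : t ∈ runStates P σ) :
    s.u = t.u ∧ s.v = t.v ∧
      (⟨Function.update s.p i (t.p i), s.m, s.u, s.v⟩ : State L Mem Lk Cv) ∈ runStates P σ := by
  induction σ using List.reverseRecOn generalizing s t with
  | nil =>
    obtain rfl : s = P.init := hs
    obtain rfl : t = P.init := ht
    simp [runStates]
  | append_singleton σ a ih =>
    obtain ⟨s₀, hs₀, hs⟩ := mem_statesFrom_append.1 hs
    obtain ⟨t₀, ht₀, ht⟩ := mem_statesFrom_append.1 ht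
    rw [mem_statesFrom_singleton] at hs ht
    obtain ⟨hu, hv, hmem⟩ := ih hs₀ ht₀
    obtain ⟨j, b⟩ := a
    obtain ⟨n, hP, hp, hU, hV⟩ := step_iff.1 hs
    obtain ⟨n', hP', hp', hU', hV'⟩ := step_iff.1 ht
    rw [← hu] at hU'
    rw [← hv] at hV'
    refine ⟨?_, ?_, ?_⟩
    · cases b <;> simp only [UStep] at hU hU' <;> grind
    · unfold VStep at hV hV'
      rcases hc : b.cv with _ | c <;> simp only [hc] at hV hV'
      · rw [hV, hV']
      · obtain ⟨S, hS, hV⟩ := hV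
        obtain ⟨S', hS', hV'⟩ := hV'
        rw [hV, hV']
        cases b <;> simp only [WStep] at hS hS' <;> grind
    · refine mem_statesFrom_append.2 ⟨_, hmem, mem_statesFrom_singleton.2 (step_iff.2 ?_)⟩
      -- If the last action is by `i`, its location follows the run to `t` while the rest follows
      -- the run to `s`; otherwise the whole step is that of `s`.
      by_cases hji : j = i
      · subst hji
        refine ⟨n', ?_, by simp [hp, hp'], hU, hV⟩
        simp only [Function.update_self]
        by_cases hb : ∃ t, b = .loc t
        · obtain ⟨⟨⟩, rfl⟩ := hb
          obtain ⟨r, hr, h₁, h₂⟩ := hP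
          obtain ⟨r', hr', h₁', h₂'⟩ := hP'
          simp only [Stmt.mk.injEq] at hr hr'
          refine ⟨r, ?_, h₁, h₂⟩
          simp only [Stmt.mk.injEq]
          tauto
        · rw [not_exists] at hb
          rw [hP.mem_eq hb]
          exact hP'.change_mem hb _
      · refine ⟨n, ?_, ?_, hU, hV⟩
        · simpa only [Function.update_of_ne hji] using hP
        · simp only [hp, hp', Function.update_of_ne (Ne.symm hji)]
          exact Function.update_comm hji _ _ _

/-- A run without actions of thread `i` does not depend on the location of `i`, does not change
it, and does not change which mutexes `i` holds. -/
theorem statesFrom_frame {P : Program L Mem Lk Cv} {i : Thread}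
    {σ : List (Action L Mem Lk Cv)} {s t : State L Mem Lk Cv} (hσ : ∀ a ∈ σ, a.thread ≠ i)
    (ht : t ∈ statesFrom P s σ) :
    t.p i = s.p i ∧ (∀ l, t.u l = (i : ℕ) ↔ s.u l = (i : ℕ)) ∧
      ∀ n, (⟨Function.update t.p i n, t.m, t.u, t.v⟩ : State L Mem Lk Cv) ∈
        statesFrom P ⟨Function.update s.p i n, s.m, s.u, s.v⟩ σ := by
  induction σ generalizing s with
  | nil =>
    obtain rfl : t = s := ht
    simp
  | cons a σ ih =>
    obtain ⟨s', h, ht⟩ := mem_statesFrom_cons.1 ht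
    obtain ⟨h₁, h₂, h₃⟩ := ih (fun b hb => hσ b (by simp [hb])) ht
    obtain ⟨j, b⟩ := a
    have hji : j ≠ i := hσ ⟨j, b⟩ (by simp)
    obtain ⟨n, hP, hp, hU, hV⟩ := step_iff.1 h
    refine ⟨by rw [h₁, hp, Function.update_of_ne hji.symm], fun l => ?_, fun n' => ?_⟩
    · rw [h₂, hU.held_iff hji]
    · refine mem_statesFrom_cons.2 ⟨⟨Function.update s'.p i n', s'.m, s'.u, s'.v⟩,
        step_iff.2 ⟨n, ?_, ?_, hU, hV⟩, h₃ n'⟩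
      · simpa only [Function.update_of_ne hji] using hP
      · simp only [hp]
        exact Function.update_comm hji _ _ _

/-- The guard mentions only what other threads cannot change: the location of `i` and whether `i`
holds `l`. -/
theorem enabled_w1_iff {P : Program L Mem Lk Cv} {s : State L Mem Lk Cv} {i : Thread} {c : Cv}
    {l : Lk} : Enabled P s ⟨i, .w1 c l⟩ ↔
      s.u l = (i : ℕ) ∧ ∃ n' r, ⟨i, s.p i, n', .wait c l, r⟩ ∈ P.stmts := by
  constructor
  · rintro ⟨s', h⟩
    obtain ⟨n', hP, -, hU, -⟩ := step_iff.1 h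
    exact ⟨hU.1, hP.2.2⟩
  · rintro ⟨hu, n', r, ht⟩
    exact ⟨_, .w1 _ _ _ _ _ _ _ _ _ _ ht rfl hu⟩

end Transitions

/-! ### Causality on names: extremal elements, generated pasts, linearizations -/

section Causality

variable {A : Type u}

theorem Name.notMem_causes_self (e : Name A) : e ∉ e.causes := by
  induction e using Name.induction with
  | h a H ih =>
    intro h
    exact ih _ (by simpa using h) h

/-- Causality is transitive on the elements of `C`. -/
def CausesTrans (C : Finset (Name A)) : Prop := ∀ e ∈ C, CausallyClosed e.causes

theorem CausesTrans.mono {C D : Finset (Name A)} (hD : CausesTrans D) (h : C ⊆ D) :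
    CausesTrans C := fun e he => hD e (h he)

/-- The number of causes serves as a rank: its extreme values locate causally maximal and minimal
events. -/
theorem CausesTrans.card_lt {C : Finset (Name A)} (hC : CausesTrans C) {e e' : Name A}
    (he : e ∈ C) (h : e' ∈ e.causes) : e'.causes.card < e.causes.card :=
  Finset.card_lt_card ((hC e he e' h).ssubset_of_mem_notMem h e'.notMem_causes_self)

/-- Every element lies below a causally maximal one. -/
theorem CausesTrans.exists_maximal {C : Finset (Name A)} (hC : CausesTrans C) {e : Name A}
    (he : e ∈ C) : ∃ f ∈ C, e ∈ f.localConf ∧ ∀ g ∈ C, f ∉ g.causes := by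
  obtain ⟨f, hf, hmax⟩ := Finset.exists_max_image (C.filter fun f => e ∈ f.localConf)
    (fun f => f.causes.card) ⟨e, by simp [he, Name.localConf]⟩
  rw [Finset.mem_filter] at hf
  refine ⟨f, hf.1, hf.2, fun g hg hfg => ?_⟩
  have hlt := hC.card_lt hg hfg
  refine (hmax g (Finset.mem_filter.2 ⟨hg, ?_⟩)).not_gt hlt
  have hef := hf.2
  simp only [Name.localConf, Finset.mem_insert] at hef ⊢
  rcases hef with rfl | hef
  · exact .inr hfg
  · exact .inr (hC g hg f hfg hef)

theorem CausesTrans.exists_minimal {C : Finset (Name A)} (hC : CausesTrans C)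
    (hne : C.Nonempty) : ∃ f ∈ C, ∀ g ∈ C, g ∉ f.causes := by
  obtain ⟨f, hf, hmin⟩ := Finset.exists_min_image C (fun f => f.causes.card) hne
  exact ⟨f, hf, fun g hg hgf => (hmin g hg).not_gt (hC.card_lt hf hgf)⟩

theorem mem_localConfs {M : Finset (Name A)} {e : Name A} :
    e ∈ localConfs M ↔ ∃ f ∈ M, e = f ∨ e ∈ f.causes := by
  simp [localConfs, Name.localConf]

theorem subset_localConfs (M : Finset (Name A)) : M ⊆ localConfs M :=
  fun e he => mem_localConfs.2 ⟨e, he, .inl rfl⟩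

theorem localConfs_union (M N : Finset (Name A)) :
    localConfs (M ∪ N) = localConfs M ∪ localConfs N := by
  ext e
  simp only [mem_localConfs, Finset.mem_union]
  grind

theorem CausallyClosed.localConfs_subset {C M : Finset (Name A)} (hC : CausallyClosed C)
    (hM : M ⊆ C) : localConfs M ⊆ C := by
  intro e he
  obtain ⟨f, hf, rfl | he⟩ := mem_localConfs.1 he
  · exact hM hf
  · exact hC f (hM hf) he

theorem CausesTrans.causallyClosed_localConfs {M : Finset (Name A)} (hM : CausesTrans M) :
    CausallyClosed (localConfs M) := by
  intro e he g hg
  obtain ⟨f, hf, rfl | he⟩ := mem_localConfs.1 he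
  · exact mem_localConfs.2 ⟨_, hf, .inr hg⟩
  · exact mem_localConfs.2 ⟨f, hf, .inr (hM f hf _ he hg)⟩

/-- The maximal elements of `[M]` belong to `M`. -/
theorem mem_of_maximal_localConfs {M : Finset (Name A)} {e : Name A} (he : e ∈ localConfs M)
    (hmax : ∀ f ∈ localConfs M, e ∉ f.causes) : e ∈ M := by
  obtain ⟨f, hf, rfl | h⟩ := mem_localConfs.1 he
  · exact hf
  · exact absurd h (hmax f (subset_localConfs M hf))

/-- An enumeration of `C` that respects causality. -/
structure IsLinearization (C : Finset (Name A)) (es : List (Name A)) : Prop where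
  nodup : es.Nodup
  mem_iff : ∀ e, e ∈ es ↔ e ∈ C
  pairwise : es.Pairwise fun e e' => e' ∉ e.causes

theorem IsLinearization.perm {C : Finset (Name A)} {es fs : List (Name A)}
    (hes : IsLinearization C es) (hfs : IsLinearization C fs) : es.Perm fs :=
  (List.perm_ext_iff_of_nodup hes.nodup hfs.nodup).2 fun e => by rw [hes.mem_iff, hfs.mem_iff]

theorem IsLinearization.append {K D : Finset (Name A)} {es fs : List (Name A)}
    (hes : IsLinearization K es) (hfs : IsLinearization D fs) (hdisj : Disjoint K D)
    (h : ∀ e ∈ K, ∀ f ∈ D, f ∉ e.causes) : IsLinearization (K ∪ D) (es ++ fs) where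
  nodup := List.nodup_append'.2 ⟨hes.nodup, hfs.nodup, fun e he he' =>
    Finset.disjoint_left.1 hdisj ((hes.mem_iff e).1 he) ((hfs.mem_iff e).1 he')⟩
  mem_iff e := by simp [hes.mem_iff, hfs.mem_iff]
  pairwise := List.pairwise_append.2 ⟨hes.pairwise, hfs.pairwise, fun e he f hf =>
    h e ((hes.mem_iff e).1 he) f ((hfs.mem_iff f).1 hf)⟩

theorem IsLinearization.filter {C D : Finset (Name A)} {es : List (Name A)}
    (hes : IsLinearization C es) (h : D ⊆ C) : IsLinearization D (es.filter (· ∈ D)) where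
  nodup := hes.nodup.filter _
  mem_iff e := by
    simp only [List.mem_filter, hes.mem_iff, decide_eq_true_eq]
    exact ⟨fun h => h.2, fun he => ⟨h he, he⟩⟩
  pairwise := hes.pairwise.filter _

theorem isLinearization_singleton (e : Name A) : IsLinearization {e} [e] where
  nodup := List.nodup_singleton e
  mem_iff f := by simp
  pairwise := List.pairwise_singleton _ _

end Causality

/-! ### Configurations, enabledness of `w1`, and causes of `w1` events -/

section Configurations

variable {L Mem Lk Cv : Type*} {P : Program L Mem Lk Cv}

theorem IsEvent.causes_isConfiguration {e : Ev L Mem Lk Cv} (he : IsEvent P e) :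
    IsConfiguration P e.causes := by
  cases he with
  | intro a C events closed free enabled dep =>
    rw [Name.causes_mk]
    exact ⟨events, closed, free⟩

theorem IsEvent.enabledAt {e : Ev L Mem Lk Cv} (he : IsEvent P e) :
    EnabledAt P (configStates P e.causes) e.label := by
  cases he with
  | intro a C events closed free enabled dep =>
    rwa [Name.causes_mk, Name.label_mk]

theorem IsEvent.dep_of_maximal {e f : Ev L Mem Lk Cv} (he : IsEvent P e) (hf : f ∈ e.causes)
    (hmax : ∀ g ∈ e.causes, f ∉ g.causes) : Dep e.label f.label := by
  cases he with
  | intro a C events closed free enabled dep =>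
    rw [Name.causes_mk] at hf hmax
    rw [Name.label_mk]
    exact dep f hf hmax

namespace IsConfiguration

variable {C D K : Finset (Ev L Mem Lk Cv)}

theorem causesTrans (hC : IsConfiguration P C) : CausesTrans C :=
  fun e he => (hC.1 e he).causes_isConfiguration.2.1

theorem subset (hC : IsConfiguration P C) (hKC : K ⊆ C) (hK : CausallyClosed K) :
    IsConfiguration P K :=
  ⟨fun e he => hC.1 e (hKC he), hK, fun e he e' he' => hC.2.2 e (hKC he) e' (hKC he')⟩

/-- Distinct events of a configuration with dependent labels are causally related. -/
theorem related (hC : IsConfiguration P C) {e f : Ev L Mem Lk Cv} (he : e ∈ C) (hf : f ∈ C)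
    (hd : Dep e.label f.label) : e = f ∨ e ∈ f.causes ∨ f ∈ e.causes := by
  by_contra! h
  exact hC.2.2 e he f hf ⟨h.1, h.2.1, h.2.2, hd⟩

/-- All interleavings of a configuration reach the same states. -/
theorem mem_configStates_iff (hdrf : P.DataRaceFree) (hC : IsConfiguration P C)
    {es : List (Ev L Mem Lk Cv)} (hes : IsLinearization C es) {s : State L Mem Lk Cv} :
    s ∈ configStates P C ↔ s ∈ runStates P (es.map Name.label) := by
  constructor
  · rintro ⟨σ, ⟨fs, h₁, h₂, h₃, rfl⟩, hs⟩
    have hfs : IsLinearization C fs := ⟨h₁, h₂, h₃⟩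
    have hinit : Reachable P P.init := ⟨[], rfl⟩
    have := statesFrom_eq_of_perm hdrf hinit (hfs.perm hes) hfs.pairwise hes.pairwise hfs.nodup
      fun e he e' he' => hC.2.2 e ((h₂ e).1 he) e' ((h₂ e').1 he')
    rwa [runStates, ← this]
  · intro hs
    exact ⟨_, ⟨es, hes.nodup, hes.mem_iff, hes.pairwise, rfl⟩, hs⟩

theorem reachable_of_mem {s : State L Mem Lk Cv} (hs : s ∈ configStates P C) : Reachable P s := by
  obtain ⟨σ, -, hs⟩ := hs
  exact ⟨σ, hs⟩

/-- A run of `D` can be split into a run of a causally closed subset followed by the rest. -/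
theorem exists_split (hdrf : P.DataRaceFree) (hD : IsConfiguration P D) (hKD : K ⊆ D)
    (hK : CausallyClosed K) {t : State L Mem Lk Cv} (ht : t ∈ configStates P D) :
    ∃ es fs, IsLinearization K es ∧ IsLinearization (D \ K) fs ∧
      IsLinearization D (es ++ fs) ∧
      ∃ s ∈ configStates P K, t ∈ statesFrom P s (fs.map Name.label) := by
  obtain ⟨σ, ⟨gs, h₁, h₂, h₃, rfl⟩, hs⟩ := id ht
  have hgs : IsLinearization D gs := ⟨h₁, h₂, h₃⟩
  -- Moving the events of `K` to the front of an enumeration respects causality because `K` is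
  -- causally closed.
  have hes := hgs.filter hKD
  have hfs := hgs.filter (Finset.sdiff_subset (s := D) (t := K))
  have happ := hes.append hfs Finset.disjoint_sdiff fun e he f hf hfe =>
    (Finset.mem_sdiff.1 hf).2 (hK e he hfe)
  rw [Finset.union_sdiff_of_subset hKD] at happ
  rw [hD.mem_configStates_iff hdrf happ, List.map_append] at ht
  obtain ⟨s, hs, ht⟩ := mem_statesFrom_append.1 ht
  exact ⟨_, _, hes, hfs, happ, s,
    ((hD.subset hKD hK).mem_configStates_iff hdrf hes).2 hs, ht⟩

/-- A transition after a run of a causally closed set extends the run by an event. -/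
theorem mem_configStates_insert (hdrf : P.DataRaceFree) {e : Ev L Mem Lk Cv}
    (hC : IsConfiguration P (insert e C)) (hcl : CausallyClosed C) (he : e ∉ C)
    {t : State L Mem Lk Cv} :
    t ∈ configStates P (insert e C) ↔ ∃ s ∈ configStates P C, Step P s e.label t := by
  have hsub : C ⊆ insert e C := Finset.subset_insert _ _
  have key : ∀ es, IsLinearization C es → IsLinearization (insert e C) (es ++ [e]) := by
    intro es hes
    have := hes.append (isLinearization_singleton e) (by simpa using he) (by
      intro f hf g hg hgf
      rw [Finset.mem_singleton.1 hg] at hgf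
      exact he (hcl f hf hgf))
    rwa [Finset.union_comm] at this
  constructor
  · intro ht
    obtain ⟨es, fs, hes, -, -, -⟩ := hC.exists_split hdrf hsub hcl ht
    rw [hC.mem_configStates_iff hdrf (key es hes), List.map_append] at ht
    obtain ⟨s, hs, ht⟩ := mem_statesFrom_append.1 ht
    exact ⟨s, ((hC.subset hsub hcl).mem_configStates_iff hdrf hes).2 hs, by simpa using ht⟩
  · rintro ⟨s, hs, hst⟩
    obtain ⟨σ, ⟨es, h₁, h₂, h₃, rfl⟩, hs⟩ := hs
    rw [hC.mem_configStates_iff hdrf (key es ⟨h₁, h₂, h₃⟩), List.map_append]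
    exact mem_statesFrom_append.2 ⟨s, hs, by simpa using hst⟩

variable {i : Thread} {c : Cv} {l : Lk}

theorem thread_ne_of_sdiff {fs : List (Ev L Mem Lk Cv)} (hfs : IsLinearization (D \ K) fs)
    (hi : ∀ e ∈ D, e.label.thread = i → e ∈ K) :
    ∀ a ∈ fs.map Name.label, a.thread ≠ i := by
  intro a ha hai
  obtain ⟨f, hf, rfl⟩ := List.mem_map.1 ha
  have := Finset.mem_sdiff.1 ((hfs.mem_iff f).1 hf)
  exact this.2 (hi f this.1 hai)

/-- Whether a `w1` action of thread `i` is enabled depends only on the events of `i`: passing to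
a smaller configuration with the same events of `i`. -/
theorem enabledAt_w1_of_superset (hdrf : P.DataRaceFree) (hD : IsConfiguration P D) (hKD : K ⊆ D)
    (hK : CausallyClosed K) (hi : ∀ e ∈ D, e.label.thread = i → e ∈ K)
    (h : EnabledAt P (configStates P D) ⟨i, .w1 c l⟩) :
    EnabledAt P (configStates P K) ⟨i, .w1 c l⟩ := by
  obtain ⟨t, ht, hen⟩ := h
  obtain ⟨es, fs, -, hfs, -, s, hs, hst⟩ := hD.exists_split hdrf hKD hK ht
  obtain ⟨hp, hu, -⟩ := statesFrom_frame (thread_ne_of_sdiff hfs hi) hst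
  rw [enabled_w1_iff, hu, hp] at hen
  exact ⟨s, hs, enabled_w1_iff.2 hen⟩

/-- Whether a `w1` action of thread `i` is enabled depends only on the events of `i`: passing to
a larger configuration with the same events of `i`. -/
theorem enabledAt_w1_of_subset (hdrf : P.DataRaceFree) (hD : IsConfiguration P D) (hKD : K ⊆ D)
    (hK : CausallyClosed K) (hi : ∀ e ∈ D, e.label.thread = i → e ∈ K)
    (hne : (configStates P D).Nonempty)
    (h : EnabledAt P (configStates P K) ⟨i, .w1 c l⟩) :
    EnabledAt P (configStates P D) ⟨i, .w1 c l⟩ := by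
  obtain ⟨s', hs', hen⟩ := h
  obtain ⟨t, ht⟩ := hne
  obtain ⟨es, fs, hes, hfs, happ, s, hs, hst⟩ := hD.exists_split hdrf hKD hK ht
  obtain ⟨-, hu, hrun⟩ := statesFrom_frame (thread_ne_of_sdiff hfs hi) hst
  have hKc := hD.subset hKD hK
  -- The action is enabled at `s'`, but the available run of `D` continues from `s`. Both states
  -- come from one label sequence, so the location of `i` in `s'` can be grafted onto `s`, and the
  -- remaining events leave it alone.
  rw [hKc.mem_configStates_iff hdrf hes] at hs hs'
  obtain ⟨hus, -, hmem⟩ := runStates_exchange i _ hs hs'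
  refine ⟨⟨Function.update t.p i (s'.p i), t.m, t.u, t.v⟩, ?_, ?_⟩
  · rw [hD.mem_configStates_iff hdrf happ, List.map_append]
    exact mem_statesFrom_append.2 ⟨_, hmem, hrun _⟩
  · rw [enabled_w1_iff] at hen ⊢
    refine ⟨(hu l).2 (hus ▸ hen.1), ?_⟩
    simpa using hen.2

/-- `[e_t]` is the union of the local configurations of the events of thread `i`. -/
theorem threadPast_eq (hK : IsConfiguration P K) (i : Thread) :
    threadPast K i = localConfs (K.filter fun e => e.label.thread = i) := by
  unfold threadPast lastOf
  split_ifs with h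
  · obtain ⟨heK, hei, hmax⟩ := h.choose_spec
    set e := h.choose
    refine Finset.Subset.antisymm ?_ ?_
    · intro f hf
      simp only [Option.elim, Name.localConf, Finset.mem_insert] at hf
      exact mem_localConfs.2 ⟨e, Finset.mem_filter.2 ⟨heK, hei⟩, hf⟩
    · intro f hf
      obtain ⟨g, hg, hfg⟩ := mem_localConfs.1 hf
      obtain ⟨hgK, hgi⟩ := Finset.mem_filter.1 hg
      simp only [Option.elim, Name.localConf, Finset.mem_insert]
      -- Events of one thread in a configuration are totally ordered, so all lie at or below the
      -- last one.
      rcases hK.related heK hgK (.inl (hei.trans hgi.symm)) with h | h | h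
      · rwa [h]
      · exact absurd h (hmax g hgK hgi)
      · rcases hfg with rfl | hfg
        · exact .inr h
        · exact .inr (hK.causesTrans e heK g h hfg)
  · have : K.filter (fun e => e.label.thread = i) = ∅ := by
      by_contra hne
      obtain ⟨e, he⟩ := Finset.nonempty_iff_ne_empty.2 hne
      obtain ⟨f, hf, -, hmax⟩ :=
        (hK.causesTrans.mono (Finset.filter_subset _ K)).exists_maximal he
      rw [Finset.mem_filter] at hf
      exact h ⟨f, hf.1, hf.2, fun g hg hgi => hmax g (Finset.mem_filter.2 ⟨hg, hgi⟩)⟩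
    simp [this, localConfs]

theorem mem_threadPast (hK : IsConfiguration P K) {e : Ev L Mem Lk Cv} (he : e ∈ K)
    (hi : e.label.thread = i) : e ∈ threadPast K i := by
  rw [hK.threadPast_eq]
  exact subset_localConfs _ (Finset.mem_filter.2 ⟨he, hi⟩)

theorem threadPast_subset (hK : IsConfiguration P K) (i : Thread) : threadPast K i ⊆ K := by
  rw [hK.threadPast_eq]
  exact hK.2.1.localConfs_subset (Finset.filter_subset _ _)

/-- If a `w1` action `a` of thread `i` is enabled after a configuration, then those of its events
that belong to a set of events on which `a` depends, together with their causes, are the causes of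
an event with label `a`, provided that they include all events of `i`. -/
theorem isEvent_mk_w1 (hdrf : P.DataRaceFree) (hD : IsConfiguration P D)
    {N : Finset (Ev L Mem Lk Cv)} (hND : N ⊆ D)
    (hi : ∀ e ∈ D, e.label.thread = i → e ∈ localConfs N)
    (hdep : ∀ e ∈ N, Dep (⟨i, .w1 c l⟩ : Action L Mem Lk Cv) e.label)
    (h : EnabledAt P (configStates P D) ⟨i, .w1 c l⟩) :
    IsEvent P (Name.mk ⟨i, .w1 c l⟩ (localConfs N)) := by
  have hsub := hD.2.1.localConfs_subset hND
  have hcl := (hD.causesTrans.mono hND).causallyClosed_localConfs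
  have hconf := hD.subset hsub hcl
  exact .intro _ _ hconf.1 hcl hconf.2.2 (hD.enabledAt_w1_of_superset hdrf hsub hcl hi h)
    fun e he hmax => hdep e (mem_of_maximal_localConfs he hmax)

end IsConfiguration

theorem dep_w1_of_lost {X : Finset (Ev L Mem Lk Cv)} {i : Thread} {c : Cv} {l : Lk}
    {e : Ev L Mem Lk Cv} (he : e ∈ lostNotifications X c i) :
    Dep (⟨i, .w1 c l⟩ : Action L Mem Lk Cv) e.label := by
  rw [lostNotifications, Finset.mem_filter] at he
  refine .inr (.inl ?_)
  rcases he.2 with h | h | ⟨S, -, h⟩ <;> simp [DepRow, h]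

/-- A causally maximal event of the causes of a `w1` event, if it belongs to another thread, is a
lost signal, or a broadcast that does not wake up the waiting thread. -/
theorem IsEvent.lost_of_maximal (hdrf : P.DataRaceFree) (hwait : P.WaitBlocks)
    {e f : Ev L Mem Lk Cv} (he : IsEvent P e) {i : Thread} {c : Cv} {l : Lk}
    (hl : e.label = ⟨i, .w1 c l⟩) (hf : f ∈ e.causes) (hmax : ∀ g ∈ e.causes, f ∉ g.causes)
    (hfi : f.label.thread ≠ i) :
    f.label.effect = .sig c 0 ∨ ∃ S : Set Thread, i ∉ S ∧ f.label.effect = .bro c S := by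
  have hdep := he.dep_of_maximal hf hmax
  obtain ⟨s, hs, hen⟩ := he.enabledAt
  have hK := he.causes_isConfiguration
  -- Being maximal, `f` can be scheduled last, so its effect is visible in the state where the
  -- action of `e` is enabled.
  have hcl : CausallyClosed (e.causes.erase f) := by
    intro g hg x hx
    rw [Finset.mem_erase] at hg ⊢
    refine ⟨?_, hK.2.1 g hg.2 hx⟩
    rintro rfl
    exact hmax g hg.2 hx
  have hins : insert f (e.causes.erase f) = e.causes := Finset.insert_erase hf
  have hreach : Reachable P s := IsConfiguration.reachable_of_mem hs
  rw [← hins] at hs hK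
  obtain ⟨s₁, -, hst⟩ := (hK.mem_configStates_insert hdrf hcl (Finset.notMem_erase _ _)).1 hs
  rw [hl] at hdep hen
  obtain ⟨hu, -⟩ := enabled_w1_iff.1 hen
  generalize f.label = b at hdep hst hfi ⊢
  obtain ⟨j, b⟩ := b
  obtain ⟨n, -, -, hU, hV⟩ := step_iff.1 hst
  have hji : (j : ℕ) ≠ i := fun h => hfi (PNat.coe_injective h)
  have hi := i.ne_zero
  -- A woken thread can only perform `w2`, yet `w1` is enabled here.
  have hnot : -((i : ℕ) : ℤ) ∉ s.v c := by
    intro hmem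
    obtain ⟨c', l', h⟩ := hwait s hreach i c (.inr hmem) _ hen
    simp at h
  have hrow : DepRow i (.w1 c l) j b ∨ DepRow j b i (.w1 c l) := hdep.resolve_left (Ne.symm hfi)
  -- A mutex effect leaves `l` free or held by `j`, against `hu`; waking `i` leaves `-i` in `v c`,
  -- against `hnot`.
  cases b with
  | loc t => simp [DepRow] at hrow
  | acq l' =>
    obtain rfl : l' = l := by simpa [DepRow, eq_comm] using hrow
    obtain ⟨-, hU⟩ := hU
    simp [hU, hji] at hu
  | rel l' =>
    obtain rfl : l' = l := by simpa [DepRow, eq_comm] using hrow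
    obtain ⟨-, hU⟩ := hU
    simp [hU, hi.symm] at hu
  | w1 c' l' =>
    obtain rfl : l' = l := by simpa [DepRow, eq_comm] using hrow
    obtain ⟨-, hU⟩ := hU
    simp [hU, hi.symm] at hu
  | w2 c' l' =>
    obtain rfl : l' = l := by simpa [DepRow, eq_comm] using hrow
    obtain ⟨-, hU⟩ := hU
    simp [hU, hji] at hu
  | sig c' k =>
    obtain rfl : c' = c := by
      simp only [DepRow] at hrow
      grind
    obtain ⟨S', ⟨rfl, -, -⟩ | ⟨hk, -, rfl⟩, hV⟩ := hV
    · exact .inl rfl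
    · have hki : k = i := by
        simp only [DepRow] at hrow
        grind
      simp [hV, hki] at hnot
  | bro c' W =>
    obtain rfl : c' = c := by
      simp only [DepRow] at hrow
      grind
    obtain ⟨S', ⟨-, rfl⟩, hV⟩ := hV
    refine .inr ⟨W, fun hiW => hnot ?_, rfl⟩
    rw [hV, Function.update_self]
    exact .inr ⟨i, hiW, rfl⟩

end Configurations

/-! ### The two inclusions -/

section ConflictingExtensions

variable {L Mem Lk Cv : Type*} {P : Program L Mem Lk Cv} {C : Finset (Ev L Mem Lk Cv)}
  {i : Thread} {c : Cv} {l : Lk}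

theorem IsConfiguration.insert {e : Ev L Mem Lk Cv} (hC : IsConfiguration P C)
    (he : IsEvent P e) (hsub : e.causes ⊆ C)
    (hdep : ∀ f ∈ C, Dep e.label f.label → f ∈ e.causes) :
    IsConfiguration P (insert e C) := by
  refine ⟨?_, ?_, ?_⟩
  · intro f hf
    rcases Finset.mem_insert.1 hf with rfl | hf
    exacts [he, hC.1 f hf]
  · intro f hf
    rcases Finset.mem_insert.1 hf with rfl | hf
    exacts [hsub.trans (Finset.subset_insert _ _),
      (hC.2.1 f hf).trans (Finset.subset_insert _ _)]
  · rintro f hf g hg ⟨hne, hfg, hgf, hd⟩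
    rcases Finset.mem_insert.1 hf with rfl | hf' <;> rcases Finset.mem_insert.1 hg with rfl | hg'
    · exact hne rfl
    · exact hgf (hdep g hg' hd)
    · exact hfg (hdep f hf' hd.symm)
    · exact hC.2.2 f hf' g hg' ⟨hne, hfg, hgf, hd⟩

/-- Shrinking the causes of `e` while keeping all events of `i` preserves enabledness; the new event
is unordered with `e` in the same thread, hence in conflict with it. -/
theorem cexWait_subset (hdrf : P.DataRaceFree) (hC : IsConfiguration P C) {e e' : Ev L Mem Lk Cv}
    (he : e ∈ C) (hl : e.label = ⟨i, .w1 c l⟩) (he' : e' ∈ cexWait e) :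
    e' ∈ cex P C ∧ IsW1 e' := by
  have hev := hC.1 e he
  have hK := hev.causes_isConfiguration
  have hKC : e.causes ⊆ C := hC.2.1 e he
  rw [cexWait, hl] at he'
  obtain ⟨M, hM, -, hne, rfl⟩ := he'
  have hMK : M ⊆ e.causes :=
    hM.trans ((Finset.filter_subset _ _).trans Finset.sdiff_subset)
  have hTK := Finset.filter_subset (fun f : Ev L Mem Lk Cv => f.label.thread = i) e.causes
  -- The thread past is itself generated by events of `i`, so the new causes are `[N]` for a single
  -- set `N`.
  rw [hK.threadPast_eq, ← localConfs_union] at hne ⊢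
  set N := M ∪ e.causes.filter fun f => f.label.thread = i
  have hNK : N ⊆ e.causes := Finset.union_subset hMK hTK
  have hi : ∀ f ∈ e.causes, f.label.thread = i → f ∈ localConfs N := fun f hf hfi =>
    subset_localConfs N (Finset.mem_union_right _ (Finset.mem_filter.2 ⟨hf, hfi⟩))
  have hsub : localConfs N ⊆ e.causes := hK.2.1.localConfs_subset hNK
  have heN : e ∉ localConfs N := fun h => e.notMem_causes_self (hsub h)
  have hevent : IsEvent P (Name.mk ⟨i, .w1 c l⟩ (localConfs N)) := by
    refine hK.isEvent_mk_w1 hdrf hNK hi (fun f hf => ?_) (hl ▸ hev.enabledAt)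
    rcases Finset.mem_union.1 hf with hf | hf
    · exact dep_w1_of_lost (hM hf)
    · exact .inl (Finset.mem_filter.1 hf).2.symm
  -- As an event of `i` among the causes of `e`, it would lie in the retained thread past and so
  -- cause itself.
  have hnot : Name.mk (⟨i, .w1 c l⟩ : Action L Mem Lk Cv) (localConfs N) ∉ e.causes := by
    intro h
    have := hi _ h (by simp)
    exact Name.notMem_causes_self (Name.mk (⟨i, .w1 c l⟩ : Action L Mem Lk Cv) (localConfs N))
      (by simpa using this)
  have hne' : e ≠ Name.mk ⟨i, .w1 c l⟩ (localConfs N) := by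
    intro h
    rw [h] at hne
    simp at hne
  have hdep : Dep e.label (Name.mk (⟨i, .w1 c l⟩ : Action L Mem Lk Cv) (localConfs N)).label :=
    .inl (by rw [hl, Name.label_mk])
  refine ⟨⟨⟨hevent, fun h => ?_, by simpa using hsub.trans hKC⟩, fun h => ?_⟩, c, l, by simp⟩
  · rcases hC.related he h hdep with h | h | h
    · exact hne' h
    · rw [Name.causes_mk] at h
      exact heN h
    · exact hnot h
  · exact h.2.2.2 e (Finset.mem_insert_of_mem he) _ (Finset.mem_insert_self _ _)
      ⟨hne', by simpa using heN, hnot, hdep⟩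

/-- If a `w1` action of thread `i` is enabled after `K ⊆ C`, where `C` is a maximal run
configuration, then `C` contains further events of thread `i`. -/
theorem exists_thread_event (hdrf : P.DataRaceFree) (hC : Maximal (IsRunConfiguration P) C)
    {K : Finset (Ev L Mem Lk Cv)} (hKC : K ⊆ C) (hK : CausallyClosed K)
    (hen : EnabledAt P (configStates P K) ⟨i, .w1 c l⟩) :
    ∃ e ∈ C, e.label.thread = i ∧ e ∉ K := by
  by_contra! hi
  obtain ⟨hCc, hne⟩ := hC.prop
  have henC := hCc.enabledAt_w1_of_subset hdrf hKC hK hi hne hen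
  -- Taking all events of `C` on which the action depends leaves nothing in `C` for the new event to
  -- conflict with.
  have hNC := Finset.filter_subset
    (fun f : Ev L Mem Lk Cv => Dep (⟨i, .w1 c l⟩ : Action L Mem Lk Cv) f.label) C
  set N := C.filter fun f => Dep (⟨i, .w1 c l⟩ : Action L Mem Lk Cv) f.label
  have hN : ∀ f ∈ C, Dep (⟨i, .w1 c l⟩ : Action L Mem Lk Cv) f.label → f ∈ localConfs N :=
    fun f hf hd => subset_localConfs N (Finset.mem_filter.2 ⟨hf, hd⟩)
  have hev : IsEvent P (Name.mk ⟨i, .w1 c l⟩ (localConfs N)) :=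
    hCc.isEvent_mk_w1 hdrf hNC (fun f hf hfi => hN f hf (.inl hfi.symm))
      (fun f hf => (Finset.mem_filter.1 hf).2) henC
  set e := Name.mk (⟨i, .w1 c l⟩ : Action L Mem Lk Cv) (localConfs N) with he
  have hcauses : e.causes = localConfs N := by simp [he]
  have hlabel : e.label = ⟨i, .w1 c l⟩ := by simp [he]
  have heC : e ∉ C := by
    intro h
    have := hN e h (.inl (by rw [hlabel]))
    rw [← hcauses] at this
    exact e.notMem_causes_self this
  have hins : IsConfiguration P (insert e C) :=
    hCc.insert hev (hcauses ▸ hCc.2.1.localConfs_subset hNC) (by rwa [hcauses, hlabel])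
  obtain ⟨s, hs, t, hst⟩ := henC
  have ht : t ∈ configStates P (insert e C) :=
    (hins.mem_configStates_insert hdrf hCc.2.1 heC).2 ⟨s, hs, hlabel ▸ hst⟩
  exact heC (hC.2 ⟨hins, t, ht⟩ (Finset.subset_insert _ _) (Finset.mem_insert_self _ _))

/-- A maximal run configuration that contains the causes of a `w1` event contains an event with
the same label, all of whose causes in the same thread are among those causes. -/
theorem exists_w1_event (hwf : P.WellFormed) (hdrf : P.DataRaceFree)
    (hC : Maximal (IsRunConfiguration P) C) {e' : Ev L Mem Lk Cv} (he' : IsEvent P e')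
    (hsub : e'.causes ⊆ C) (hl : e'.label = ⟨i, .w1 c l⟩) :
    ∃ e ∈ C, e.label = ⟨i, .w1 c l⟩ ∧ e ∉ e'.causes ∧
      ∀ f ∈ e.causes, f.label.thread = i → f ∈ e'.causes := by
  have hK' := he'.causes_isConfiguration
  have hen := hl ▸ he'.enabledAt
  obtain ⟨hCc, s, hs⟩ := hC.prop
  obtain ⟨e₀, he₀, hi₀, hn₀⟩ := exists_thread_event hdrf hC hsub hK'.2.1 hen
  obtain ⟨e, he, hmin⟩ := (hCc.causesTrans.mono (Finset.filter_subset
    (fun f => f.label.thread = i ∧ f ∉ e'.causes) C)).exists_minimal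
    ⟨e₀, Finset.mem_filter.2 ⟨he₀, hi₀, hn₀⟩⟩
  obtain ⟨heC, hei, hen'⟩ := Finset.mem_filter.1 he
  have hpast : ∀ f ∈ e.causes, f.label.thread = i → f ∈ e'.causes := by
    intro f hf hfi
    by_contra h
    exact hmin f (Finset.mem_filter.2 ⟨hCc.2.1 e heC hf, hfi, h⟩) hf
  refine ⟨e, heC, ?_, hen', hpast⟩
  have hK := (hCc.1 e heC).causes_isConfiguration
  have hDcl : CausallyClosed (e.causes ∪ e'.causes) := by
    intro f hf
    rcases Finset.mem_union.1 hf with hf | hf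
    · exact (hK.2.1 f hf).trans Finset.subset_union_left
    · exact (hK'.2.1 f hf).trans Finset.subset_union_right
  have hDC : e.causes ∪ e'.causes ⊆ C := Finset.union_subset (hCc.2.1 e heC) hsub
  have heD : e ∉ e.causes ∪ e'.causes := by
    simp [e.notMem_causes_self, hen']
  have hD := hCc.subset hDC hDcl
  have hins : IsConfiguration P (insert e (e.causes ∪ e'.causes)) := by
    refine hCc.subset (Finset.insert_subset heC hDC) fun f hf => ?_
    rcases Finset.mem_insert.1 hf with rfl | hf
    · exact Finset.subset_union_left.trans (Finset.subset_insert _ _)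
    · exact (hDcl f hf).trans (Finset.subset_insert _ _)
  -- A run of `C` restricts to its causally closed subsets; this yields a state after the union
  -- where the label of `e` is enabled.
  obtain ⟨-, -, -, -, -, t, ht, -⟩ :=
    hCc.exists_split hdrf (Finset.insert_subset heC hDC) hins.2.1 hs
  obtain ⟨s₁, hs₁, hst⟩ := (hins.mem_configStates_insert hdrf hDcl heD).1 ht
  have hw1 : EnabledAt P (configStates P (e.causes ∪ e'.causes)) ⟨i, .w1 c l⟩ := by
    refine hD.enabledAt_w1_of_subset hdrf Finset.subset_union_right hK'.2.1 ?_ ⟨s₁, hs₁⟩ hen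
    intro f hf hfi
    rcases Finset.mem_union.1 hf with hf | hf
    exacts [hpast f hf hfi, hf]
  obtain ⟨s₂, hs₂, hen₂⟩ := hw1
  obtain ⟨_, ⟨es, h₁, h₂, h₃, rfl⟩, -⟩ := id hs₁
  have hes : IsLinearization (e.causes ∪ e'.causes) es := ⟨h₁, h₂, h₃⟩
  rw [hD.mem_configStates_iff hdrf hes] at hs₁ hs₂
  generalize e.label = a at hei hst ⊢
  obtain ⟨j, b⟩ := a
  obtain rfl : j = i := hei
  by_contra hb
  -- The two labels may be enabled at different states of one run, as well-formedness allows; `w1`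
  -- is neither local nor a signal.
  rcases hwf _ j b (.w1 c l) ⟨s₁, hs₁, t, hst⟩ ⟨s₂, hs₂, hen₂⟩ (fun h => hb (by rw [h])) with
    ⟨t, t', -, h⟩ | ⟨c, k, k', -, h⟩ <;> simp at h

/-- `M` consists of the maximal causes of `e'` outside the thread past; of conflict, only `e' ∉ C`
matters, and it separates `e'` from `e`. -/
theorem mem_cexWait (hwf : P.WellFormed) (hwait : P.WaitBlocks) (hdrf : P.DataRaceFree)
    (hC : Maximal (IsRunConfiguration P) C) {e' : Ev L Mem Lk Cv} (hext : e' ∈ extensions P C)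
    (hl' : e'.label = ⟨i, .w1 c l⟩) :
    ∃ e ∈ C, IsW1 e ∧ e' ∈ cexWait e := by
  obtain ⟨he', heC', hsub⟩ := hext
  obtain ⟨e, heC, hl, hnot, hpast⟩ := exists_w1_event hwf hdrf hC he' hsub hl'
  have hCc := hC.prop.1
  have hK := (hCc.1 e heC).causes_isConfiguration
  have hK' := he'.causes_isConfiguration
  have hbefore : ∀ f ∈ e'.causes, Dep (⟨i, .w1 c l⟩ : Action L Mem Lk Cv) f.label →
      f ∈ e.causes := by
    intro f hf hd
    -- Conflict-freeness of `C` orders `f` and `e`; since `e` is not a cause of `e'`, only `f` below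
    -- `e` remains.
    rcases hCc.related heC (hsub hf) (hl ▸ hd) with h | h | h
    · exact absurd (h ▸ hf) hnot
    · exact absurd (hK'.2.1 f hf h) hnot
    · exact h
  have hT : threadPast e.causes i = threadPast e'.causes i := by
    rw [hK.threadPast_eq, hK'.threadPast_eq]
    congr 1
    ext f
    simp only [Finset.mem_filter]
    exact ⟨fun h => ⟨hpast f h.1 h.2, h.2⟩, fun h => ⟨hbefore f h.1 (.inl h.2.symm), h.2⟩⟩
  refine ⟨e, heC, ⟨c, l, by rw [hl]⟩, ?_⟩
  rw [cexWait, hl]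
  set M := e'.causes.filter fun f => f ∉ threadPast e'.causes i ∧ ∀ g ∈ e'.causes, f ∉ g.causes
  have hMK' : M ⊆ e'.causes := Finset.filter_subset _ _
  have hunion : localConfs M ∪ threadPast e'.causes i = e'.causes := by
    refine Finset.Subset.antisymm
      (Finset.union_subset (hK'.2.1.localConfs_subset hMK') (hK'.threadPast_subset i)) ?_
    intro f hf
    obtain ⟨g, hg, hfg, hmax⟩ := hK'.causesTrans.exists_maximal hf
    rw [Name.localConf, Finset.mem_insert] at hfg
    rw [Finset.mem_union]
    by_cases hgT : g ∈ threadPast e'.causes i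
    · right
      rcases hfg with rfl | hfg
      · exact hgT
      · rw [hK'.threadPast_eq] at hgT ⊢
        exact (hK'.causesTrans.mono (Finset.filter_subset _ _)).causallyClosed_localConfs
          g hgT hfg
    · exact .inl (mem_localConfs.2 ⟨g, Finset.mem_filter.2 ⟨hg, hgT, hmax⟩, hfg⟩)
  refine ⟨M, fun f hf => ?_, fun f hf g hg => (Finset.mem_filter.1 hf).2.2 g (hMK' hg), ?_, ?_⟩
  · obtain ⟨hfK', hfT, hmax⟩ := Finset.mem_filter.1 hf
    have hfi : f.label.thread ≠ i := fun h => hfT (hK'.mem_threadPast hfK' h)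
    rw [lostNotifications, Finset.mem_filter, Finset.mem_sdiff, hT]
    refine ⟨⟨hbefore f hfK' (hl' ▸ he'.dep_of_maximal hfK' hmax), hfT⟩, ?_⟩
    exact (he'.lost_of_maximal hdrf hwait hl' hfK' hmax hfi).imp_right .inr
  · rw [hT, hunion]
    -- Equal causes and labels would give `e' = e`, an element of `C`.
    intro h
    refine heC' ?_
    rwa [← e'.mk_label_causes, hl', h, ← hl, e.mk_label_causes]
  · rw [hT, hunion, ← hl', e'.mk_label_causes]

end ConflictingExtensions

end Unf

end

theorem mainTheorem3 {L Mem Lk Cv : Type*} (P : Unf.Program L Mem Lk Cv)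
    (hwf : P.WellFormed) (hwait : P.WaitBlocks) (hdrf : P.DataRaceFree)
    (C : Finset (Unf.Ev L Mem Lk Cv)) (hC : Maximal (Unf.IsRunConfiguration P) C) :
    (⋃ e ∈ {e | e ∈ C ∧ Unf.IsW1 e}, Unf.cexWait e) =
      {e' | e' ∈ Unf.cex P C ∧ Unf.IsW1 e'} := by
  ext e'
  simp only [Set.mem_iUnion, Set.mem_ofPred_eq, exists_prop]
  constructor
  · rintro ⟨e, ⟨he, c, l, hl⟩, he'⟩
    exact Unf.cexWait_subset hdrf hC.prop.1 he
      (show e.label = ⟨e.label.thread, .w1 c l⟩ by rw [← hl]) he'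
  · rintro ⟨hcex, c, l, hl⟩
    obtain ⟨e, he, hw, hmem⟩ := Unf.mem_cexWait hwf hwait hdrf hC hcex.1
      (show e'.label = ⟨e'.label.thread, .w1 c l⟩ by rw [← hl])
    exact ⟨e, ⟨he, hw⟩, hmem⟩
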